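/- Let $H$ be a real separable Hilbert space, $T>0$, and let $\phi=\phi_1+\phi_2:H\to(-\infty,\infty]$ have compact sublevels $\{\phi\le c\}$, $c\in\mathbb R$, where $\phi_1:H\to(-\infty,\infty]$ is convex, proper and lower semicontinuous with single-valued subdifferential $\partial\phi_1$ (at most one element at each point), and $\phi_2\in C^{1,\alpha}_{\rm loc}(H)$ for some $\alpha\in(0,1]$ (i.e. $\phi_2$ is Fréchet differentiable and $\mathrm D\phi_2$ is $\alpha$-Hölder continuous near every point). Here $\partial\phi(u)$, for $\phi(u)<\infty$, is the Fréchet subdifferential, i.e. the set of $\xi\in H$ with $\liminf_{v\to u}\frac{\phi(v)-\phi(u)-(\xi,v-u)}{\|v-u\|}\ge 0$; it is empty if $\phi(u)=\infty$. It has at most one element, which is again denoted by $\partial\phi(u)$, and $D(\partial\phi)=\{u:\partial\phi(u)\neq\emptyset\}$. Let $u_0\in D(\partial\phi)$ and let $\{0=t^n_0<t^n_1<\dots<t^n_{N^n}=T\}$, $n\in\mathbb N$, be partitions with steps $\tau_i^n=t_i^n-t_{i-1}^n$ and $\max_i\tau_i^n\to0$ as $n\to\infty$. For $u,v\in D(\partial\phi)$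 put $$G_i^n(u,v)=\phi(u)+\frac{\tau_i^n}{2}\Big\|\frac{u-v}{\tau_i^n}\Big\|^2+\frac{\tau_i^n}{2}\|\partial\phi(u)\|^2-\phi(v).$$ (i) Let $u_i^n\in D(\partial\phi)$, $0\le i\le N^n$, be such that $u_0^n=u_0$ and $\sum_{i=1}^{N^n}G_i^n(u_i^n,u_{i-1}^n)^+\to0$ as $n\to\infty$. Then there are a subsequence (not relabeled) and a function $u\in H^1(0,T;H)$ such that the piecewise affine interpolants $\widehat u^n$ of the values $u^n_i$ on the partitions converge to $u$ strongly in $H^1(0,T;H)$, and $u$ solves the gradient flow $$u'(t)+\partial\phi(u(t))=0\quad\text{for a.e. }t\in(0,T),\qquad u(0)=u_0.$$ (ii) This applies to the implicit Euler scheme: if $u_0^n=u_0$ and $u_i^n$ minimizes $v\mapsto\phi(v)+\frac{\tau_i^n}{2}\big\|\frac{v-u_{i-1}^n}{\tau_i^n}\big\|^2$ over $H$ for all $n$ and $1\le i\le N^n$, then $u_i^n\in D(\partial\phi)$ for $0\le i\le N^n$ and $\sum_{i=1}^{N^n}G_i^n(u_i^n,u_{i-1}^n)^+\to0$; hence the conclusion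 of (i) holds. -/

import Mathlib

open Filter Topology MeasureTheory Set
open scoped ContDiff NNReal ENNReal

noncomputable section

namespace DeGiorgi

variable {H : Type*} [NormedAddCommGroup H] [InnerProductSpace ℝ H]

/-- Convexity of an extended-real-valued functional. -/
def IsConvex (φ : H → EReal) : Prop :=
  ∀ x y : H, ∀ a b : ℝ, 0 < a → 0 < b → a + b = 1 →
    φ (a • x + b • y) ≤ (a : EReal) * φ x + (b : EReal) * φ y

/-- A functional with values in `(-∞, ∞]` that is not identically `∞`. -/
def IsProper (φ : H → EReal) : Prop :=
  (∀ u, φ u ≠ ⊥) ∧ ∃ u, φ u ≠ ⊤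

/-- All sublevels `{φ ≤ c}`, `c` real, are (strongly) compact. -/
def HasCompactSublevels (φ : H → EReal) : Prop :=
  ∀ c : ℝ, IsCompact {u : H | φ u ≤ (c : EReal)}

/-- The class `C^{1,α}_loc(H)`: Fréchet differentiable, with a derivative that is
`α`-Hölder continuous near every point. -/
def IsC1HolderLoc (α : ℝ≥0) (f : H → ℝ) : Prop :=
  Differentiable ℝ f ∧
    ∀ x : H, ∃ U ∈ 𝓝 x, ∃ C : ℝ≥0, HolderOnWith C α (fderiv ℝ f) U

/-- The Fréchet subdifferential `∂φ(u)`; it is empty outside the essential domain of `φ`. -/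
def subdiff (φ : H → EReal) (u : H) : Set H :=
  {ξ : H | φ u ≠ ⊤ ∧
    0 ≤ liminf (fun v : H =>
      (φ v - φ u - ((inner ℝ ξ (v - u) : ℝ) : EReal)) / ((‖v - u‖ : ℝ) : EReal)) (𝓝[≠] u)}

/-- The domain `D(∂φ)` of the subdifferential. -/
def subdiffDom (φ : H → EReal) : Set H := {u : H | (subdiff φ u).Nonempty}

/-- The subdifferential is single-valued: it has at most one element at every point. -/
def IsSingleValued (φ : H → EReal) : Prop := ∀ u : H, (subdiff φ u).Subsingleton

open Classical in
/-- The element of `∂φ(u)`, for `u ∈ D(∂φ)` and single-valued `∂φ` (zero outside `D(∂φ)`). -/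
def subgrad (φ : H → EReal) (u : H) : H :=
  if h : (subdiff φ u).Nonempty then h.some else 0

/-- The sum `φ₁ + φ₂` of an extended-real-valued and a real-valued functional. -/
def energy (φ₁ : H → EReal) (φ₂ : H → ℝ) : H → EReal := fun u => φ₁ u + (φ₂ u : EReal)

/-- The functional
`G(u,v) = φ(u) + (τ/2) ‖(u - v)/τ‖² + (τ/2) ‖∂φ(u)‖² - φ(v)` for `u, v ∈ D(∂φ)`,
where `φ(u)` and `φ(v)` are finite. -/
def G (φ : H → EReal) (τ : ℝ) (u v : H) : ℝ :=
  (φ u).toReal + τ / 2 * ‖τ⁻¹ • (u - v)‖ ^ 2 + τ / 2 * ‖subgrad φ u‖ ^ 2 - (φ v).toReal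

/-- `u` minimizes `v ↦ φ(v) + (τ/2) ‖(v - w)/τ‖²` over `H`: a step of length `τ` of the
implicit Euler scheme that starts from `w`. -/
def IsEulerStep (φ : H → EReal) (τ : ℝ) (u w : H) : Prop :=
  IsMinOn (fun v : H => φ v + ((τ / 2 * ‖τ⁻¹ • (v - w)‖ ^ 2 : ℝ) : EReal)) univ u

/-- A partition `0 = t_0 < t_1 < ... < t_N = T` (the values `t i` for `i > N` play no role). -/
structure TimePartition (T : ℝ) where
  N : ℕ
  t : ℕ → ℝ
  t_zero : t 0 = 0
  t_last : t N = T
  t_lt : ∀ i < N, t i < t (i + 1)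

/-- The step `t_{i+1} - t_i`. -/
def TimePartition.step {T : ℝ} (P : TimePartition T) (i : ℕ) : ℝ := P.t (i + 1) - P.t i

/-- The fineness: the largest step. -/
def TimePartition.fineness {T : ℝ} (P : TimePartition T) : ℝ := ⨆ i : Fin P.N, P.step i

/-- The piecewise affine interpolant on `[0,T]` of the values `w_0, ..., w_N`: it is `w_0` at `0`
and `ℓ(s) w_{j+1} + (1 - ℓ(s)) w_j`, `ℓ(s) = (s - t_j)/(t_{j+1} - t_j)`, for `s` in
`(t_j, t_{j+1}]`. -/
def TimePartition.affineInterp {T : ℝ} (P : TimePartition T) (w : ℕ → H) (s : ℝ) : H :=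
  if s ≤ 0 then w 0
  else ∑ j ∈ Finset.range P.N,
    (Ioc (P.t j) (P.t (j + 1))).indicator
      (fun r => ((r - P.t j) / P.step j) • w (j + 1) + (1 - (r - P.t j) / P.step j) • w j) s

/-- The residual `∑_{i=1}^N G_i(w_i, w_{i-1})⁺`. -/
def residual {T : ℝ} (φ : H → EReal) (P : TimePartition T) (w : ℕ → H) : ℝ :=
  ∑ i ∈ Finset.range P.N, max (G φ (P.step i) (w (i + 1)) (w i)) 0

/-- `u ∈ H¹(0,T;H)` with weak derivative `u'`. -/
structure HasH1Deriv (T : ℝ) (u u' : ℝ → H) : Prop where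
  memLp : MemLp u 2 (volume.restrict (Ioo 0 T))
  memLp_deriv : MemLp u' 2 (volume.restrict (Ioo 0 T))
  weak : ∀ ψ : ℝ → ℝ, ContDiff ℝ ∞ ψ → HasCompactSupport ψ → tsupport ψ ⊆ Ioo 0 T →
    ∫ s in Ioo 0 T, deriv ψ s • u s = - ∫ s in Ioo 0 T, ψ s • u' s

/-- Strong convergence `v n → u` in `H¹(0,T;H)`. -/
def TendstoH1 (T : ℝ) (v : ℕ → ℝ → H) (u : ℝ → H) : Prop :=
  ∃ (v' : ℕ → ℝ → H) (u' : ℝ → H),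
    (∀ n, HasH1Deriv T (v n) (v' n)) ∧ HasH1Deriv T u u' ∧
    Tendsto (fun n => eLpNorm (v n - u) 2 (volume.restrict (Ioo 0 T))) atTop (𝓝 0) ∧
    Tendsto (fun n => eLpNorm (v' n - u') 2 (volume.restrict (Ioo 0 T))) atTop (𝓝 0)

/-- `u ∈ H¹(0,T;H)` (continuous representative) solves `u' + ∂φ(u) ∋ 0` a.e. in `(0,T)`,
`u(0) = u₀`. -/
def SolvesGradientFlow (φ : H → EReal) (T : ℝ) (u₀ : H) (u : ℝ → H) : Prop :=
  ContinuousOn u (Icc 0 T) ∧ u 0 = u₀ ∧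
    ∃ u' : ℝ → H, HasH1Deriv T u u' ∧
      ∀ᵐ s ∂(volume.restrict (Ioo 0 T)), -(u' s) ∈ subdiff φ (u s)

/-- Along a subsequence, the piecewise affine interpolants of the values `w n i` on the partitions
`P n` converge strongly in `H¹(0,T;H)` to a solution of the gradient flow. -/
def SubconvergesToSolution (φ : H → EReal) (T : ℝ) (u₀ : H) (P : ℕ → TimePartition T)
    (w : ℕ → ℕ → H) : Prop :=
  ∃ (σ : ℕ → ℕ) (u : ℝ → H), StrictMono σ ∧ SolvesGradientFlow φ T u₀ u ∧
    TendstoH1 T (fun k => (P (σ k)).affineInterp (w (σ k))) u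

end DeGiorgi

end

noncomputable section

namespace DeGiorgi

variable {H : Type*} [NormedAddCommGroup H] [InnerProductSpace ℝ H]

/-! Summing the terms `G` gives a discrete energy inequality (`energy_add_le_residual`): the final
energy, plus half the action (the squared `L²` norm of the velocities), plus half the integral of
the squared slope, is at most the initial energy plus the residual. Hence the velocities are bounded
in `L²` and the values stay in one compact sublevel, so the affine interpolants converge uniformly
to some `u` along a subsequence (`exists_subseq_tendstoUniformlyOn_primitive`). The energy is lower
semicontinuous, and so is the slope, because limits of subgradients are subgradients
(`lowerSemicontinuous_slope`). So in the limit the action is at most `2 (φ(u₀) - φ(u(T)))` minus the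
integral `S` of the squared slope along `u`.

The reverse bound is a chain rule inequality: `φ(u(0)) - φ(u(T))` is at most half the action of `u`
plus `S / 2`. It follows by summing the subgradient inequality over a fine partition. A convex plus
a `C¹` functional satisfies this inequality up to an error `δ ‖y - x‖` that is uniform on sublevels,
and the nodes can be shifted so that the Riemann sum of the squared slope does not exceed its
integral (`IsRegularEnergy.exists_partition_le`).

The two bounds show that the limit of the actions is not larger than the action of the limit, and
the parallelogram law turns this into strong convergence of the velocities
(`exists_tendsto_of_action_bound`). Equality in the energy balance then forces `‖u' + ∂φ(u)‖² = 0`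
almost everywhere (`IsRegularEnergy.ae_neg_mem_subdiff`).

For the Euler scheme the subgradient at the new value is minus the velocity, so the almost-convexity
inequality bounds each `G` by `δ τ ‖velocity‖`, with `δ` arbitrarily small for fine partitions. -/

/-! ### Subdifferential of a convex plus a differentiable functional. -/

lemma coe_le_sub_sub_iff (x : EReal) (c p i : ℝ) :
    (c : EReal) ≤ x - p - i ↔ ((p : EReal) + ((i + c : ℝ) : EReal)) ≤ x := by
  induction x with
  | bot =>
    rw [← EReal.coe_add]
    simp
  | top => simp
  | coe x =>
    norm_cast
    constructor <;> intro h <;> linarith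

/-- This form avoids quotients in `EReal`. The punctured neighbourhood can be filled in because the
inequality is an equality at `v = u`. -/
lemma mem_subdiff_iff {φ : H → EReal} {u ξ : H} (hb : φ u ≠ ⊥) :
    ξ ∈ subdiff φ u ↔ φ u ≠ ⊤ ∧ ∀ ε > 0, ∀ᶠ v in 𝓝 u,
      φ u + ((inner ℝ ξ (v - u) - ε * ‖v - u‖ : ℝ) : EReal) ≤ φ v := by
  refine and_congr_right fun ht => ?_
  obtain ⟨p, hp⟩ : ∃ p : ℝ, φ u = p := ⟨(φ u).toReal, (EReal.coe_toReal ht hb).symm⟩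
  rw [le_liminf_iff', hp]
  have key : ∀ ε : ℝ, ∀ v, v ≠ u →
      (((-ε : ℝ) : EReal) ≤
        (φ v - p - ((inner ℝ ξ (v - u) : ℝ) : EReal)) / ((‖v - u‖ : ℝ) : EReal) ↔
      (p : EReal) + ((inner ℝ ξ (v - u) - ε * ‖v - u‖ : ℝ) : EReal) ≤ φ v) := by
    intro ε v hv
    have hn : 0 < ‖v - u‖ := norm_pos_iff.2 (sub_ne_zero.2 hv)
    rw [EReal.le_div_iff_mul_le (by exact_mod_cast hn) (EReal.coe_ne_top _), ← EReal.coe_mul,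
      coe_le_sub_sub_iff]
    ring_nf
  constructor
  · intro h ε hε
    have := h ((-ε : ℝ) : EReal) (by exact_mod_cast neg_lt_zero.2 hε)
    rw [eventually_nhdsWithin_iff] at this
    filter_upwards [this] with v hv
    by_cases hvu : v = u
    · subst hvu; simp [hp]
    · exact (key ε v hvu).1 (hv hvu)
  · intro h y hy
    obtain ⟨z, hyz, hz⟩ := EReal.lt_iff_exists_real_btwn.1 hy
    have hz' : z < 0 := by exact_mod_cast hz
    rw [eventually_nhdsWithin_iff]
    filter_upwards [h (-z) (neg_pos.2 hz')] with v hv hvu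
    refine hyz.le.trans ?_
    have := (key (-z) v hvu).2 hv
    simpa using this

lemma energy_ne_bot {X : Type*} {φ₁ : X → EReal} {φ₂ : X → ℝ} {u : X} (h : φ₁ u ≠ ⊥) :
    φ₁ u + (φ₂ u : EReal) ≠ ⊥ := by
  simp [EReal.add_eq_bot_iff, h]

lemma energy_ne_top_iff {X : Type*} {φ₁ : X → EReal} {φ₂ : X → ℝ} {u : X} :
    φ₁ u + (φ₂ u : EReal) ≠ ⊤ ↔ φ₁ u ≠ ⊤ := by
  induction φ₁ u with
  | bot => simp
  | top => simp
  | coe x => exact iff_of_true (EReal.coe_ne_top (x + φ₂ u)) (EReal.coe_ne_top x)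

lemma energy_add_le_iff {X : Type*} {φ₁ : X → EReal} {φ₂ : X → ℝ} {u v : X} {r : ℝ} :
    φ₁ u + (φ₂ u : EReal) + (r : EReal) ≤ φ₁ v + (φ₂ v : EReal) ↔
      φ₁ u + ((r - (φ₂ v - φ₂ u) : ℝ) : EReal) ≤ φ₁ v := by
  induction φ₁ u with
  | bot => simp
  | top =>
    rw [EReal.top_add_coe, EReal.top_add_coe, EReal.top_add_coe, top_le_iff, top_le_iff]
    exact not_iff_not.1 energy_ne_top_iff
  | coe x =>
    induction φ₁ v with
    | bot =>
      rw [EReal.bot_add, le_bot_iff, le_bot_iff]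
      exact iff_of_false (EReal.coe_ne_bot (x + φ₂ u + r))
        (EReal.coe_ne_bot (x + (r - (φ₂ v - φ₂ u))))
    | top => simp [← EReal.coe_add]
    | coe y =>
      norm_cast
      constructor <;> intro h <;> linarith

/-- The Fréchet subdifferential of a convex functional plus a differentiable one satisfies a
global inequality. -/
lemma IsConvex.subdiff_energy_le {φ₁ : H → EReal} {φ₂ : H → ℝ} (hc : IsConvex φ₁)
    (hb : ∀ u, φ₁ u ≠ ⊥) (hd : Differentiable ℝ φ₂) {u ξ : H}
    (hξ : ξ ∈ subdiff (energy φ₁ φ₂) u) (v : H) :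
    φ₁ u + ((inner ℝ ξ (v - u) - fderiv ℝ φ₂ u (v - u) : ℝ) : EReal) ≤ φ₁ v := by
  obtain ⟨ht, h⟩ := (mem_subdiff_iff (φ := energy φ₁ φ₂) (energy_ne_bot (hb u))).1 hξ
  replace ht := energy_ne_top_iff.1 ht
  obtain ⟨p, hp⟩ : ∃ p : ℝ, φ₁ u = p := ⟨(φ₁ u).toReal, (EReal.coe_toReal ht (hb u)).symm⟩
  by_cases hv : φ₁ v = ⊤
  · simp [hv]
  obtain ⟨q, hq⟩ : ∃ q : ℝ, φ₁ v = q := ⟨(φ₁ v).toReal, (EReal.coe_toReal hv (hb v)).symm⟩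
  rw [hp, hq]
  norm_cast
  refine le_of_forall_pos_le_add fun ε hε => ?_
  set n := ‖v - u‖
  -- Two errors `δ t n` arise at the point `u + t (v - u)`: one from the Fréchet subgradient
  -- inequality, one from the linearization of `φ₂`.
  obtain ⟨δ, hδ, hδn⟩ : ∃ δ > 0, 2 * δ * n ≤ ε := by
    refine ⟨ε / (2 * (n + 1)), by positivity, ?_⟩
    have : 0 ≤ n := norm_nonneg _
    rw [show 2 * (ε / (2 * (n + 1))) * n = ε * (n / (n + 1)) by field_simp]
    have : n / (n + 1) ≤ 1 := by rw [div_le_one (by positivity)]; linarith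
    nlinarith
  have h1 := h δ hδ
  have h2 := (hd u).hasFDerivAt.isLittleO.def hδ
  have hlim : Tendsto (fun t : ℝ => u + t • (v - u)) (𝓝[>] 0) (𝓝 u) := by
    have : Tendsto (fun t : ℝ => u + t • (v - u)) (𝓝 0) (𝓝 (u + (0 : ℝ) • (v - u))) :=
      (Continuous.tendsto (by fun_prop) 0)
    simp only [zero_smul, add_zero] at this
    exact this.mono_left nhdsWithin_le_nhds
  obtain ⟨t, ⟨⟨h1, h2⟩, ht0⟩, ht1⟩ := (((hlim.eventually (h1.and h2)).and
    (eventually_mem_nhdsWithin)).and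
    (nhdsWithin_le_nhds (eventually_lt_nhds (zero_lt_one' ℝ)))).exists
  have ht0 : 0 < t := ht0
  -- Convexity turns the local inequality at a small `t` into the global one after division by `t`.
  have hcv := hc v u t (1 - t) ht0 (by linarith) (by ring)
  rw [show t • v + (1 - t) • u = u + t • (v - u) by module] at hcv
  replace h1 := energy_add_le_iff.1 h1
  have h3 := h1.trans hcv
  rw [hp, hq] at h3
  norm_cast at h3
  simp only [add_sub_cancel_left, map_smul, inner_smul_right, norm_smul, Real.norm_eq_abs,
    abs_of_pos ht0, smul_eq_mul] at h2 h3
  have h4 := (abs_le.1 h2).2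
  have : t * (p + (inner ℝ ξ (v - u) - fderiv ℝ φ₂ u (v - u))) ≤ t * (q + ε) := by
    have : t * (2 * δ * n) ≤ t * ε := mul_le_mul_of_nonneg_left hδn ht0.le
    linarith
  exact le_of_mul_le_mul_left this ht0

lemma mem_subdiff_energy {φ₁ : H → EReal} {φ₂ : H → ℝ} (hb : ∀ u, φ₁ u ≠ ⊥)
    (hd : Differentiable ℝ φ₂) {u ξ : H} (ht : φ₁ u ≠ ⊤)
    (h : ∀ v, φ₁ u + ((inner ℝ ξ (v - u) - fderiv ℝ φ₂ u (v - u) : ℝ) : EReal) ≤ φ₁ v) :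
    ξ ∈ subdiff (energy φ₁ φ₂) u := by
  refine (mem_subdiff_iff (φ := energy φ₁ φ₂) (energy_ne_bot (hb u))).2
    ⟨energy_ne_top_iff.2 ht, fun ε hε => ?_⟩
  filter_upwards [(hd u).hasFDerivAt.isLittleO.def hε] with v hv
  refine energy_add_le_iff.2 (le_trans (add_le_add_right (EReal.coe_le_coe_iff.2 ?_) _) (h v))
  have := (abs_le.1 hv).1
  linarith

/-- Subtracting the gradient of `φ₂` maps `∂(φ₁ + φ₂)(u)` injectively into `∂φ₁(u)`. -/
lemma IsSingleValued.energy [CompleteSpace H] {φ₁ : H → EReal} {φ₂ : H → ℝ} (hc : IsConvex φ₁)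
    (hb : ∀ u, φ₁ u ≠ ⊥) (hd : Differentiable ℝ φ₂) (hs : IsSingleValued φ₁) :
    IsSingleValued (energy φ₁ φ₂) := by
  have key : ∀ u ξ, ξ ∈ subdiff (DeGiorgi.energy φ₁ φ₂) u →
      ξ - (InnerProductSpace.toDual ℝ H).symm (fderiv ℝ φ₂ u) ∈ subdiff φ₁ u := by
    intro u ξ h
    rw [show φ₁ = DeGiorgi.energy φ₁ (fun _ => (0 : ℝ)) by ext u; simp [DeGiorgi.energy]]
    refine mem_subdiff_energy hb (by fun_prop) (energy_ne_top_iff.1 h.1) fun v => ?_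
    have := hc.subdiff_energy_le hb hd h v
    simpa [inner_sub_left] using this
  intro u ξ h ξ' h'
  simpa using hs u (key u ξ h) (key u ξ' h')

/-- A `C¹` function is strictly differentiable uniformly at the points of a compact set. -/
lemma exists_uniform_fderiv_bound {φ₂ : H → ℝ} (hd : Differentiable ℝ φ₂)
    (hcont : Continuous (fderiv ℝ φ₂)) {K : Set H} (hK : IsCompact K) {δ : ℝ} (hδ : 0 < δ) :
    ∃ r > 0, ∀ x ∈ K, ∀ y, ‖y - x‖ < r →
      ‖φ₂ y - φ₂ x - fderiv ℝ φ₂ x (y - x)‖ ≤ δ * ‖y - x‖ := by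
  have := hK.uniformContinuousAt_of_continuousAt (fderiv ℝ φ₂) (fun a _ => hcont.continuousAt)
    (Metric.dist_mem_uniformity hδ)
  obtain ⟨r, hr, h⟩ := Metric.mem_uniformity_dist.1 this
  refine ⟨r, hr, fun x hx y hy => ?_⟩
  refine (convex_ball x r).norm_image_sub_le_of_norm_fderiv_le' (𝕜 := ℝ)
    (fun z _ => hd z) (fun z hz => ?_) (Metric.mem_ball_self hr)
    (by rwa [Metric.mem_ball, dist_eq_norm])
  have := h (a := x) (b := z) (by rwa [dist_comm]) hx
  simp only [mem_ofPred_eq] at this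
  rw [← dist_eq_norm, dist_comm]; exact this.le

/-! ### The slope and its lower semicontinuity. -/

/-- The least norm of an element of the subdifferential (`⊤` outside its domain). -/
def slope (φ : H → EReal) (u : H) : ℝ≥0∞ := ⨅ ξ ∈ subdiff φ u, ‖ξ‖ₑ

lemma IsSingleValued.slope_eq {φ : H → EReal} (h : IsSingleValued φ) {u ξ : H}
    (hξ : ξ ∈ subdiff φ u) : slope φ u = ‖ξ‖ₑ :=
  le_antisymm (iInf₂_le ξ hξ) (le_iInf₂ fun _ hη => by rw [h u hη hξ])

lemma IsSingleValued.subgrad_eq {φ : H → EReal} (h : IsSingleValued φ) {u ξ : H}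
    (hξ : ξ ∈ subdiff φ u) : subgrad φ u = ξ := by
  have : (subdiff φ u).Nonempty := ⟨ξ, hξ⟩
  rw [subgrad, dif_pos this]
  exact h u this.some_mem hξ

lemma subgrad_mem {φ : H → EReal} {u : H} (h : u ∈ subdiffDom φ) : subgrad φ u ∈ subdiff φ u := by
  have h : (subdiff φ u).Nonempty := h
  rw [subgrad, dif_pos h]
  exact h.some_mem

lemma mem_subdiffDom_of_slope_lt_top {φ : H → EReal} {u : H} (h : slope φ u < ⊤) :
    u ∈ subdiffDom φ := by
  simp only [slope, iInf_lt_iff] at h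
  obtain ⟨ξ, hξ, -⟩ := h
  exact ⟨ξ, hξ⟩

/-- A bounded sequence in a Hilbert space converges weakly along an ultrafilter. -/
lemma exists_ultrafilter_tendsto_inner [CompleteSpace H] {ξ : ℕ → H} {R : ℝ}
    (h : ∀ n, ‖ξ n‖ ≤ R) :
    ∃ (l : Ultrafilter ℕ) (x : H), (l : Filter ℕ) ≤ atTop ∧ ‖x‖ ≤ R ∧
      ∀ v, Tendsto (fun n => (inner ℝ (ξ n) v : ℝ)) l (𝓝 (inner ℝ x v)) := by
  let l : Ultrafilter ℕ := Ultrafilter.of atTop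
  -- Banach–Alaoglu, transported to `H` by the Riesz isomorphism.
  have hK := WeakDual.isCompact_closedBall (𝕜 := ℝ) (E := H) 0 R
  let f : ℕ → WeakDual ℝ H := fun n =>
    StrongDual.toWeakDual (InnerProductSpace.toDual ℝ H (ξ n))
  have hf : ∀ n, f n ∈ WeakDual.toStrongDual ⁻¹' Metric.closedBall (0 : StrongDual ℝ H) R := by
    intro n
    simp only [mem_preimage, mem_closedBall_zero_iff, f]
    change ‖InnerProductSpace.toDual ℝ H (ξ n)‖ ≤ R
    simpa using h n
  obtain ⟨y, hy, hl⟩ := hK.ultrafilter_le_nhds (l.map f)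
    (le_principal_iff.2 (by
      rw [Ultrafilter.coe_map]
      exact Filter.mem_map.2 (Filter.univ_mem' hf)))
  refine ⟨l, (InnerProductSpace.toDual ℝ H).symm (WeakDual.toStrongDual y),
    Ultrafilter.of_le _, ?_, fun v => ?_⟩
  · simpa using hy
  · have h1 : Tendsto f l (𝓝 y) := hl
    have h2 := ((WeakDual.eval_continuous v).tendsto y).comp h1
    have h3 : (inner ℝ ((InnerProductSpace.toDual ℝ H).symm (WeakDual.toStrongDual y)) v : ℝ)
      = y v := by
      rw [InnerProductSpace.toDual_symm_apply]; rfl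
    rw [h3]
    exact h2

/-- The graph of the subdifferential is strongly-weakly closed: the global inequality
`IsConvex.subdiff_energy_le` passes to the limit when the points converge strongly and the
subgradients weakly. Bounded subgradients have weak limits, and the norm bound survives. -/
lemma lowerSemicontinuous_slope [CompleteSpace H] {φ₁ : H → EReal} {φ₂ : H → ℝ}
    (hc : IsConvex φ₁) (hp : IsProper φ₁) (hlsc : LowerSemicontinuous φ₁)
    (hd : Differentiable ℝ φ₂) (hcont : Continuous (fderiv ℝ φ₂)) :
    LowerSemicontinuous (slope (energy φ₁ φ₂)) := by
  intro x y hy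
  by_contra hne
  rw [not_eventually] at hne
  obtain ⟨z, hyz, hz⟩ := exists_between hy
  have hztop : z ≠ ⊤ := ne_top_of_lt hz
  obtain ⟨xs, hxs, hxs'⟩ := exists_seq_forall_of_frequently hne
  have : ∀ n, ∃ ξ ∈ subdiff (energy φ₁ φ₂) (xs n), ‖ξ‖ₑ < z := by
    intro n
    have := (not_lt.1 (hxs' n)).trans_lt hyz
    simpa only [slope, iInf_lt_iff, exists_prop] using this
  choose ξ hξ hξz using this
  have hR : ∀ n, ‖ξ n‖ ≤ z.toReal := by
    intro n
    have := ENNReal.toReal_mono hztop (hξz n).le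
    simpa using this
  obtain ⟨l, η, hl, hη, hw⟩ := exists_ultrafilter_tendsto_inner hR
  have hxl : Tendsto xs l (𝓝 x) := hxs.mono_left hl
  have hlim : ∀ v, Tendsto (fun n => (inner ℝ (ξ n) (v - xs n) - fderiv ℝ φ₂ (xs n) (v - xs n) : ℝ))
      l (𝓝 (inner ℝ η (v - x) - fderiv ℝ φ₂ x (v - x))) := by
    intro v
    refine Tendsto.sub ?_ ?_
    · have h1 : Tendsto (fun n => (inner ℝ (ξ n) (x - xs n) : ℝ)) l (𝓝 0) := by
        have h0 : Tendsto (fun n => z.toReal * ‖x - xs n‖) l (𝓝 0) := by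
          have := (tendsto_const_nhds (x := x)).sub hxl
          simpa using (this.norm.const_mul z.toReal)
        refine squeeze_zero_norm (fun n => ?_) h0
        refine (norm_inner_le_norm _ _).trans ?_
        gcongr
        exact hR n
      have := (hw (v - x)).add h1
      simpa [← inner_add_right] using this
    · exact (isBoundedBilinearMap_apply.continuous.tendsto (fderiv ℝ φ₂ x, v - x)).comp
        (((hcont.tendsto x).comp hxl).prodMk_nhds (tendsto_const_nhds.sub hxl))
  -- The inequality is tested against every `w < φ₁ x` since `φ₁ x` is not yet known to be finite;
  -- any `v` of finite energy then shows that it is.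
  have hle : ∀ v, φ₁ v ≠ ⊤ → ∀ w < φ₁ x,
      w ≤ (((φ₁ v).toReal - (inner ℝ η (v - x) - fderiv ℝ φ₂ x (v - x)) : ℝ) : EReal) := by
    intro v hv w hw
    have h1 : ∀ᶠ n in (l : Filter ℕ), w ≤
        (((φ₁ v).toReal -
          (inner ℝ (ξ n) (v - xs n) - fderiv ℝ φ₂ (xs n) (v - xs n)) : ℝ) : EReal) := by
      filter_upwards [hxl.eventually (hlsc x w hw)] with n hn
      refine hn.le.trans ?_
      have := hc.subdiff_energy_le hp.1 hd (hξ n) v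
      have ht := energy_ne_top_iff.1 (hξ n).1
      rw [← EReal.coe_toReal hv (hp.1 v), ← EReal.coe_toReal ht (hp.1 _)] at this
      rw [← EReal.coe_toReal ht (hp.1 _)]
      norm_cast at this ⊢
      linarith
    refine ge_of_tendsto ?_ h1
    exact (continuous_coe_real_ereal.tendsto _).comp (tendsto_const_nhds.sub (hlim v))
  have hxt : φ₁ x ≠ ⊤ := by
    obtain ⟨v, hv⟩ := hp.2
    exact ne_top_of_le_ne_top (EReal.coe_ne_top _) (le_of_forall_lt_imp_le_of_dense (hle v hv))
  have hmem : η ∈ subdiff (energy φ₁ φ₂) x := by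
    refine mem_subdiff_energy hp.1 hd hxt fun v => ?_
    by_cases hv : φ₁ v = ⊤
    · simp [hv]
    have := le_of_forall_lt_imp_le_of_dense (hle v hv)
    rw [← EReal.coe_toReal hxt (hp.1 x)] at this ⊢
    rw [← EReal.coe_toReal hv (hp.1 v)]
    norm_cast at this ⊢
    linarith
  have h1 : slope (energy φ₁ φ₂) x ≤ ‖η‖ₑ := iInf₂_le η hmem
  have h2 : ‖η‖ₑ ≤ z := by
    rw [← ENNReal.ofReal_toReal hztop, ← ofReal_norm]
    exact ENNReal.ofReal_le_ofReal hη
  exact absurd (h1.trans h2) (not_le.2 hz)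

/-! ### Regular energies. -/

/-- The properties of a functional on which the convergence of the scheme relies. -/
structure IsRegularEnergy (φ : H → EReal) : Prop where
  ne_bot : ∀ u, φ u ≠ ⊥
  single : IsSingleValued φ
  lsc : LowerSemicontinuous φ
  slope_lsc : LowerSemicontinuous (slope φ)
  compact : HasCompactSublevels φ
  almost_convex : ∀ c δ : ℝ, 0 < δ → ∃ r > 0, ∀ x y ξ : H, φ x ≤ c → φ y ≤ c → ξ ∈ subdiff φ x →
    ‖y - x‖ < r → (φ x).toReal + inner ℝ ξ (y - x) - δ * ‖y - x‖ ≤ (φ y).toReal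

lemma IsC1HolderLoc.continuous_fderiv {α : ℝ≥0} (hα : 0 < α) {f : H → ℝ}
    (h : IsC1HolderLoc α f) : Continuous (fderiv ℝ f) := by
  rw [continuous_iff_continuousAt]
  intro x
  obtain ⟨U, hU, C, hC⟩ := h.2 x
  exact (hC.continuousOn hα).continuousAt hU

/-- Almost convexity adds the global inequality for `φ₁` to the linearization of `φ₂`, whose error
is uniform over base points in a compact sublevel. Semicontinuity of the sum holds because compact
sublevels are closed. -/
lemma isRegularEnergy_energy [CompleteSpace H] {φ₁ : H → EReal} {φ₂ : H → ℝ}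
    (hc : IsConvex φ₁) (hp : IsProper φ₁) (hlsc : LowerSemicontinuous φ₁)
    (hs : IsSingleValued φ₁) (hd : Differentiable ℝ φ₂) (hcont : Continuous (fderiv ℝ φ₂))
    (hK : HasCompactSublevels (energy φ₁ φ₂)) : IsRegularEnergy (energy φ₁ φ₂) where
  ne_bot u := energy_ne_bot (hp.1 u)
  single := hs.energy hc hp.1 hd
  lsc := by
    rw [lowerSemicontinuous_iff_isClosed_preimage]
    intro y
    induction y with
    | bot =>
      convert! isClosed_empty
      ext u
      have h : DeGiorgi.energy φ₁ φ₂ u ≠ ⊥ := energy_ne_bot (hp.1 u)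
      simpa using h
    | top => simp
    | coe c => exact (hK c).isClosed
  slope_lsc := lowerSemicontinuous_slope hc hp hlsc hd hcont
  compact := hK
  almost_convex := by
    intro c δ hδ
    obtain ⟨r, hr, h⟩ := exists_uniform_fderiv_bound hd hcont (hK c) hδ
    refine ⟨r, hr, fun x y ξ hx hy hξ hxy => ?_⟩
    have h1 := (abs_le.1 (h x hx y hxy)).1
    have h2 := hc.subdiff_energy_le hp.1 hd hξ y
    have hxt := energy_ne_top_iff.1 hξ.1
    have hyt : φ₁ y ≠ ⊤ := energy_ne_top_iff.1 (ne_top_of_le_ne_top (EReal.coe_ne_top _) hy)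
    rw [← EReal.coe_toReal hxt (hp.1 x), ← EReal.coe_toReal hyt (hp.1 y)] at h2
    norm_cast at h2
    simp only [DeGiorgi.energy]
    rw [EReal.toReal_add hxt (hp.1 x) (EReal.coe_ne_top _) (EReal.coe_ne_bot _),
      EReal.toReal_add hyt (hp.1 y) (EReal.coe_ne_top _) (EReal.coe_ne_bot _),
      EReal.toReal_coe, EReal.toReal_coe]
    linarith

/-! ### Square-integrable functions and their primitives. -/

lemma le_of_forall_lt_succ {t : ℕ → ℝ} {n : ℕ} (ht : ∀ i < n, t i ≤ t (i + 1)) {i j : ℕ}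
    (hij : i ≤ j) (hj : j ≤ n) : t i ≤ t j := by
  induction j, hij using Nat.le_induction with
  | base => exact le_rfl
  | succ k _ ih => exact (ih (by omega)).trans (ht k (by omega))

lemma sum_lintegral_Ioc {t : ℕ → ℝ} {n : ℕ} (ht : ∀ i < n, t i ≤ t (i + 1)) (F : ℝ → ℝ≥0∞) :
    ∑ i ∈ Finset.range n, ∫⁻ s in Ioc (t i) (t (i + 1)), F s = ∫⁻ s in Ioc (t 0) (t n), F s := by
  induction n with
  | zero => simp
  | succ n ih =>
    rw [Finset.sum_range_succ, ih fun i hi => ht i (by omega),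
      ← lintegral_union measurableSet_Ioc (Ioc_disjoint_Ioc_of_le le_rfl),
      Ioc_union_Ioc_eq_Ioc (le_of_forall_lt_succ ht n.zero_le (by omega)) (ht n (by omega))]

lemma intervalIntegrable_of_memLp {E : Type*} [NormedAddCommGroup E] {g : ℝ → E}
    (hg : MemLp g 2 volume) (a b : ℝ) :
    IntervalIntegrable g volume a b := by
  rw [intervalIntegrable_iff]
  exact (hg.restrict (Ioc (min a b) (max a b))).integrable one_le_two

lemma integrable_norm_sq {E : Type*} [NormedAddCommGroup E] {g : ℝ → E} (hg : MemLp g 2 volume) :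
    Integrable (fun s => ‖g s‖ ^ 2) := hg.integrable_norm_pow two_ne_zero

lemma norm_integral_sq_le {g : ℝ → H} (hg : MemLp g 2 volume) {a b : ℝ} (hab : a ≤ b) :
    ‖∫ s in a..b, g s‖ ^ 2 / (b - a) ≤ ∫ s in a..b, ‖g s‖ ^ 2 := by
  rcases hab.eq_or_lt with rfl | hab'
  · simp
  have hτ : 0 < b - a := sub_pos.2 hab'
  set I := ∫ s in a..b, ‖g s‖
  have h1 : ‖∫ s in a..b, g s‖ ≤ I := intervalIntegral.norm_integral_le_integral_norm hab
  have hgi := intervalIntegrable_of_memLp hg a b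
  -- Jensen's inequality, by integrating `0 ≤ (‖g‖ - m)²` with `m` the mean of `‖g‖`.
  have h2 : ∫ s in a..b, (2 * (I / (b - a)) * ‖g s‖ - (I / (b - a)) ^ 2) ≤
      ∫ s in a..b, ‖g s‖ ^ 2 := by
    refine intervalIntegral.integral_mono_on hab ((hgi.norm.const_mul _).sub (by simp))
      (integrable_norm_sq hg).intervalIntegrable fun s _ => ?_
    nlinarith [sq_nonneg (‖g s‖ - I / (b - a))]
  rw [intervalIntegral.integral_sub (hgi.norm.const_mul _) (by simp),
    intervalIntegral.integral_const_mul, intervalIntegral.integral_const, smul_eq_mul] at h2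
  refine le_trans ?_ h2
  have h3 : 2 * (I / (b - a)) * I - (b - a) * (I / (b - a)) ^ 2 = I ^ 2 / (b - a) := by
    field_simp
    ring
  change _ ≤ 2 * (I / (b - a)) * I - _
  rw [h3]
  gcongr

lemma sum_norm_integral_sq_le {g : ℝ → H} (hg : MemLp g 2 volume) {t : ℕ → ℝ} {n : ℕ}
    (ht : ∀ i < n, t i ≤ t (i + 1)) :
    ∑ i ∈ Finset.range n, ‖∫ s in (t i)..(t (i + 1)), g s‖ ^ 2 / (t (i + 1) - t i) ≤
      ∫ s in (t 0)..(t n), ‖g s‖ ^ 2 := by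
  rw [← intervalIntegral.sum_integral_adjacent_intervals
    fun k _ => (integrable_norm_sq hg).intervalIntegrable]
  exact Finset.sum_le_sum fun i hi => norm_integral_sq_le hg (ht i (Finset.mem_range.1 hi))

lemma intervalIntegral_norm_sq_le {E : Type*} [NormedAddCommGroup E] {g : ℝ → E}
    (hg : MemLp g 2 volume) {a b : ℝ} (hab : a ≤ b) :
    ∫ s in a..b, ‖g s‖ ^ 2 ≤ ∫ s, ‖g s‖ ^ 2 := by
  rw [intervalIntegral.integral_of_le hab]
  exact setIntegral_le_integral (integrable_norm_sq hg) (ae_of_all _ fun s => by positivity)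

lemma norm_integral_le_sqrt {g : ℝ → H} (hg : MemLp g 2 volume) (a b : ℝ) :
    ‖∫ s in a..b, g s‖ ≤ √(|b - a| * ∫ s, ‖g s‖ ^ 2) := by
  wlog hab : a ≤ b generalizing a b
  · rw [intervalIntegral.integral_symm, norm_neg, abs_sub_comm]
    exact this b a (le_of_not_ge hab)
  refine Real.le_sqrt_of_sq_le ?_
  rw [abs_of_nonneg (sub_nonneg.2 hab)]
  rcases hab.eq_or_lt with rfl | hab'
  · simp
  have := (norm_integral_sq_le hg hab).trans (intervalIntegral_norm_sq_le hg hab)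
  rwa [div_le_iff₀ (sub_pos.2 hab'), mul_comm] at this

lemma continuous_primitive_of_memLp {g : ℝ → H} (hg : MemLp g 2 volume) (c : H) :
    Continuous fun t => c + ∫ s in (0 : ℝ)..t, g s :=
  continuous_const.add
    (intervalIntegral.continuous_primitive (fun a b => intervalIntegrable_of_memLp hg a b) 0)

/-- Integration by parts through Fubini on the triangle `{r ≤ s}`. The constant `c` drops out
because the test function vanishes at both ends. -/
lemma hasH1Deriv_of_eq_primitive [CompleteSpace H] {T : ℝ} (hT : 0 ≤ T) {u g : ℝ → H}
    (hg : MemLp g 2 volume) {c : H} (hu : ∀ s ∈ Ioo 0 T, u s = c + ∫ r in (0 : ℝ)..s, g r) :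
    HasH1Deriv T u g := by
  have hcont := continuous_primitive_of_memLp hg c
  have hae : u =ᵐ[volume.restrict (Ioo 0 T)] fun s => c + ∫ r in (0 : ℝ)..s, g r :=
    (ae_restrict_iff' measurableSet_Ioo).2 (ae_of_all _ hu)
  refine ⟨?_, hg.restrict _, fun ψ hψ hψc hψs => ?_⟩
  · rw [memLp_congr_ae hae]
    obtain ⟨C, hC⟩ := (isCompact_Icc (a := 0) (b := T)).exists_bound_of_continuousOn
      hcont.continuousOn
    refine MemLp.of_bound hcont.aestronglyMeasurable C ?_
    exact (ae_restrict_iff' measurableSet_Ioo).2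
      (ae_of_all _ fun s hs => hC s (Ioo_subset_Icc_self hs))
  · set μ := volume.restrict (Ioo 0 T)
    have hψ0 : ψ 0 = 0 := image_eq_zero_of_notMem_tsupport fun h => lt_irrefl _ (hψs h).1
    have hψT : ψ T = 0 := image_eq_zero_of_notMem_tsupport fun h => lt_irrefl _ (hψs h).2
    have hψd : Differentiable ℝ ψ := hψ.differentiable (by simp)
    have hψ' : Continuous (deriv ψ) := hψ.continuous_deriv (by simp)
    have hFTC : ∀ a b, ∫ s in a..b, deriv ψ s = ψ b - ψ a := fun a b =>
      intervalIntegral.integral_deriv_eq_sub (fun x _ => hψd x) (hψ'.intervalIntegrable a b)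
    have hψi : Integrable (deriv ψ) μ :=
      (hψ'.integrableOn_Icc (a := 0) (b := T)).mono_set Ioo_subset_Icc_self
    have hgi : Integrable g μ := (hg.restrict _).integrable one_le_two
    have hψc : Integrable (fun s => deriv ψ s • c) μ := hψi.smul_const c
    have hψp : Integrable (fun s => deriv ψ s • ∫ r in (0 : ℝ)..s, g r) μ := by
      have : Continuous fun s => deriv ψ s • ∫ r in (0 : ℝ)..s, g r := by
        have := continuous_primitive_of_memLp hg 0
        simp only [zero_add] at this
        exact hψ'.smul this
      exact (this.integrableOn_Icc (a := 0) (b := T)).mono_set Ioo_subset_Icc_self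
    have h1 : ∫ s, deriv ψ s • u s ∂μ = ∫ s, deriv ψ s • (∫ r in (0 : ℝ)..s, g r) ∂μ := by
      rw [integral_congr_ae (g := fun s => deriv ψ s • c + deriv ψ s • ∫ r in (0 : ℝ)..s, g r)
        (by filter_upwards [hae] with s hs; rw [hs, smul_add]), integral_add hψc hψp,
        integral_smul_const, ← integral_Ioc_eq_integral_Ioo, ← intervalIntegral.integral_of_le hT,
        hFTC, hψ0, hψT, sub_self, zero_smul, zero_add]
    rw [h1]
    have hint : Integrable (Function.uncurry fun s r => ({p : ℝ × ℝ | p.2 ≤ p.1}).indicator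
        (fun p => deriv ψ p.1 • g p.2) (s, r)) (μ.prod μ) :=
      (hψi.smul_prod hgi).indicator (measurableSet_le measurable_snd measurable_fst)
    have hswap := integral_integral_swap hint
    have e1 : ∫ s, ∫ r, ({p : ℝ × ℝ | p.2 ≤ p.1}).indicator
        (fun p => deriv ψ p.1 • g p.2) (s, r) ∂μ ∂μ
        = ∫ s, deriv ψ s • (∫ r in (0 : ℝ)..s, g r) ∂μ := by
      refine integral_congr_ae ((ae_restrict_iff' measurableSet_Ioo).2 (ae_of_all _ fun s hs => ?_))
      have : (fun r => ({p : ℝ × ℝ | p.2 ≤ p.1}).indicator (fun p => deriv ψ p.1 • g p.2) (s, r)) =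
          (Iic s).indicator fun r => deriv ψ s • g r := by
        ext r; simp [indicator, mem_Iic]
      simp only [this]
      rw [integral_indicator measurableSet_Iic, integral_smul, Measure.restrict_restrict
        measurableSet_Iic, intervalIntegral.integral_of_le hs.1.le]
      congr 3
      ext r
      simp only [mem_inter_iff, mem_Iic, mem_Ioo, mem_Ioc]
      exact ⟨fun h => ⟨h.2.1, h.1⟩, fun h => ⟨h.2, h.1, h.2.trans_lt hs.2⟩⟩
    have e2 : ∫ r, ∫ s, ({p : ℝ × ℝ | p.2 ≤ p.1}).indicator
        (fun p => deriv ψ p.1 • g p.2) (s, r) ∂μ ∂μ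
        = ∫ r, - (ψ r • g r) ∂μ := by
      refine integral_congr_ae ((ae_restrict_iff' measurableSet_Ioo).2 (ae_of_all _ fun r hr => ?_))
      have : (fun s => ({p : ℝ × ℝ | p.2 ≤ p.1}).indicator (fun p => deriv ψ p.1 • g p.2) (s, r)) =
          (Ici r).indicator fun s => deriv ψ s • g r := by
        ext s; simp [indicator, mem_Ici]
      simp only [this]
      rw [integral_indicator measurableSet_Ici, integral_smul_const, Measure.restrict_restrict
        measurableSet_Ici, show Ici r ∩ Ioo 0 T = Ico r T from ?_, integral_Ico_eq_integral_Ioc,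
        ← intervalIntegral.integral_of_le hr.2.le, hFTC, hψT]
      · simp
      · ext s
        simp only [mem_inter_iff, mem_Ici, mem_Ioo, mem_Ico]
        exact ⟨fun h => ⟨h.1, h.2.2⟩, fun h => ⟨h.1, hr.1.trans_le h.1, h.2⟩⟩
    rw [← e1, hswap, e2, integral_neg]

/-! ### The energy drop along a curve, on partitions. -/

/-- Young's inequality with weight `τ`. The degenerate case is allowed because the partitions below
are only monotone; there `x ^ 2 / 0 = 0`. -/
lemma mul_le_half_sq_div_add {x y τ : ℝ} (hτ : 0 ≤ τ) (h : τ = 0 → x = 0) :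
    x * y ≤ 1 / 2 * (x ^ 2 / τ) + 1 / 2 * (τ * y ^ 2) := by
  rcases hτ.eq_or_lt with h0 | h0
  · simp [h h0.symm, ← h0]
  have h1 : 1 / 2 * (x ^ 2 / τ) + 1 / 2 * (τ * y ^ 2) - x * y = 1 / 2 * ((x - τ * y) ^ 2 / τ) := by
    field_simp
    ring
  have h2 : 0 ≤ 1 / 2 * ((x - τ * y) ^ 2 / τ) := by positivity
  linarith

lemma IsRegularEnergy.slope_sq_eq {φ : H → EReal} (h : IsRegularEnergy φ) {x : H}
    (hx : x ∈ subdiffDom φ) : slope φ x ^ 2 = ENNReal.ofReal (‖subgrad φ x‖ ^ 2) := by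
  rw [h.single.slope_eq (subgrad_mem hx), ENNReal.ofReal_pow (norm_nonneg _), ofReal_norm]

lemma IsRegularEnergy.measurable_slope_sq {φ : H → EReal} (h : IsRegularEnergy φ) {u : ℝ → H}
    (hu : Continuous u) : Measurable fun s => slope φ (u s) ^ 2 :=
  (LowerSemicontinuous.measurable (f := fun s => slope φ (u s)) fun s y hy =>
    hu.continuousAt.eventually (h.slope_lsc (u s) y hy)).pow_const 2

/-- Some uniform shift of the nodes of a uniform partition gives a Riemann sum that is bounded
by the integral. -/
lemma exists_sum_le_lintegral {F : ℝ → ℝ≥0∞} (hF : Measurable F) (a : ℝ) {h : ℝ} (hh : 0 < h)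
    (N : ℕ) : ∃ s ∈ Ioo 0 h, ∑ k ∈ Finset.range N, F (a + k * h + s) ≤
      (∫⁻ t in Ioc a (a + N * h), F t) / ENNReal.ofReal h := by
  -- The shifted cells tile the interval, so the Riemann sums average to the integral divided by
  -- `h`; some shift is no worse than the average.
  have hsum : ∫⁻ s in Ioo 0 h, ∑ k ∈ Finset.range N, F (a + k * h + s) =
      ∫⁻ t in Ioc a (a + N * h), F t := by
    rw [lintegral_finsetSum _ (fun k _ => by fun_prop)]
    have := sum_lintegral_Ioc (t := fun i : ℕ => a + i * h) (n := N)
      (fun i _ => by push_cast; nlinarith) F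
    simp only [Nat.cast_zero, zero_mul, add_zero] at this
    rw [← this]
    refine Finset.sum_congr rfl fun k _ => ?_
    rw [← (measurePreserving_add_left volume (a + k * h)).setLIntegral_comp_preimage
      measurableSet_Ioc hF, preimage_const_add_Ioc, Measure.restrict_congr_set Ioo_ae_eq_Ioc]
    congr 3
    · ring
    · push_cast; ring
  obtain ⟨s, hs, hle⟩ := exists_le_setLAverage (μ := volume) (s := Ioo 0 h)
    (f := fun s => ∑ k ∈ Finset.range N, F (a + k * h + s)) (by simp [hh]) (by simp)
    (Finset.measurable_fun_sum _ fun k _ => by fun_prop).aemeasurable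
  refine ⟨s, hs, ?_⟩
  rwa [setLAverage_eq, hsum, Real.volume_Ioo, sub_zero] at hle

/-- The drop of the energy along a curve of finite action is controlled by the action over a
partition and by the integral of the squared slope. -/
lemma IsRegularEnergy.exists_partition_le {φ : H → EReal} (hφ : IsRegularEnergy φ) {u : ℝ → H}
    (hu : Continuous u) {a b : ℝ} (hab : a < b) {c : ℝ} (hc : ∀ t ∈ Icc a b, φ (u t) ≤ c)
    (ha : u a ∈ subdiffDom φ) {S C : ℝ} (hS0 : 0 ≤ S)
    (hS : ∫⁻ t in Ioc a b, slope φ (u t) ^ 2 ≤ ENNReal.ofReal S)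
    (hC : ∀ (M : ℕ) (t : ℕ → ℝ), Monotone t → t 0 = a → t M = b →
      ∑ i ∈ Finset.range M, ‖u (t (i + 1)) - u (t i)‖ ^ 2 / (t (i + 1) - t i) ≤ C)
    {ε : ℝ} (hε : 0 < ε) :
    ∃ (M : ℕ) (t : ℕ → ℝ), Monotone t ∧ t 0 = a ∧ t M = b ∧
      (φ (u a)).toReal ≤ (φ (u b)).toReal +
        1 / 2 * ∑ i ∈ Finset.range M, ‖u (t (i + 1)) - u (t i)‖ ^ 2 / (t (i + 1) - t i) +
        1 / 2 * S + ε := by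
  have hba : 0 < b - a := sub_pos.2 hab
  -- The almost-convexity error `δ ‖Δu‖` is at most `δ/2 (‖Δu‖²/τ + τ)`, so it sums to at most `ε /
  -- 2`.
  set δ := ε / (|C| + (b - a))
  have hδ : 0 < δ := by positivity
  obtain ⟨r, hr, hconv⟩ := hφ.almost_convex c δ hδ
  obtain ⟨ρ, hρ, huc⟩ := Metric.uniformContinuousOn_iff.1
    (isCompact_Icc.uniformContinuousOn_of_continuous hu.continuousOn (s := Icc a b)) r hr
  -- The first node `a` is not a shifted one. Its slope enters with weight at most `h`, and `h A ≤
  -- ε` makes it harmless.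
  set A := ‖subgrad φ (u a)‖ ^ 2
  have hA : 0 ≤ A := by positivity
  obtain ⟨N, hN⟩ := exists_nat_gt ((b - a) / min ρ (ε / (A + 1)))
  have hm : 0 < min ρ (ε / (A + 1)) := lt_min hρ (by positivity)
  have hN0 : (0 : ℝ) < N := (by positivity : 0 < (b - a) / min ρ (ε / (A + 1))).trans hN
  set h := (b - a) / N
  have hh : 0 < h := by positivity
  have hhm : h < min ρ (ε / (A + 1)) := by
    rw [div_lt_iff₀ hm] at hN
    rw [div_lt_iff₀ hN0]
    linarith
  have hhρ : h < ρ := hhm.trans_le (min_le_left _ _)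
  have hhA : h * A ≤ ε := by
    have := (hhm.trans_le (min_le_right _ _)).le
    rw [le_div_iff₀ (by positivity)] at this
    linarith
  have hNh : N * h = b - a := by simp only [h]; field_simp
  obtain ⟨s, hs, hle⟩ := exists_sum_le_lintegral (hφ.measurable_slope_sq hu) a hh N
  rw [show a + N * h = b by linarith] at hle
  replace hle := hle.trans (ENNReal.div_le_div_right hS _)
  rw [← ENNReal.ofReal_div_of_pos hh] at hle
  have hD : ∀ k < N, u (a + k * h + s) ∈ subdiffDom φ := by
    intro k hk
    refine mem_subdiffDom_of_slope_lt_top ?_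
    have := (ENNReal.sum_lt_top.1 (hle.trans_lt ENNReal.ofReal_lt_top)) k (Finset.mem_range.2 hk)
    by_contra hcon
    rw [not_lt, top_le_iff] at hcon
    simp [hcon] at this
  have hsum : ∑ k ∈ Finset.range N, ‖subgrad φ (u (a + k * h + s))‖ ^ 2 ≤ S / h := by
    rw [Finset.sum_congr rfl fun k hk => hφ.slope_sq_eq (hD k (Finset.mem_range.1 hk)),
      ← ENNReal.ofReal_sum_of_nonneg fun _ _ => by positivity] at hle
    exact (ENNReal.ofReal_le_ofReal_iff (by positivity)).1 hle
  -- Clamping to `[a, b]` yields the nodes `a, a + s, a + s + h, …, a + s + (N - 1) h, b`. All left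
  -- endpoints of the `N + 1` cells lie in the domain of the subdifferential, and no cell is longer
  -- than `h`.
  let t : ℕ → ℝ := fun k => max a (min b (a + s + ((k : ℝ) - 1) * h))
  have htm : Monotone t := by
    intro i j hij
    have : (i : ℝ) ≤ j := by exact_mod_cast hij
    simp only [t]
    gcongr
  have ht0 : t 0 = a := by
    simp only [t, Nat.cast_zero]
    exact max_eq_left ((min_le_right _ _).trans (by linarith [hs.2]))
  have htM : t (N + 1) = b := by
    simp only [t]
    push_cast
    rw [min_eq_left (by linarith [hs.1]), max_eq_right hab.le]
  have hti : ∀ k < N, t (k + 1) = a + k * h + s := by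
    intro k hk
    simp only [t]
    push_cast
    have h1 : ((k : ℝ) + 1) * h ≤ N * h := by
      gcongr
      exact_mod_cast hk
    have h2 : 0 ≤ (k : ℝ) * h := by positivity
    rw [min_eq_right (by linarith [hs.2]), max_eq_right (by linarith [hs.1])]
    ring
  have htI : ∀ k ≤ N + 1, t k ∈ Icc a b := fun k hk =>
    ⟨ht0 ▸ htm k.zero_le, htM ▸ htm hk⟩
  have hstep : ∀ k, t (k + 1) - t k ≤ h := by
    intro k
    simp only [t]
    have h1 : min b (a + s + ((k + 1 : ℕ) - 1) * h) ≤ min b (a + s + ((k : ℝ) - 1) * h) + h := by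
      rw [← min_add_add_right]
      refine min_le_min (by linarith) (le_of_eq ?_)
      push_cast
      ring
    have h2 : max a (min b (a + s + ((k + 1 : ℕ) - 1) * h)) ≤
        max a (min b (a + s + ((k : ℝ) - 1) * h)) + h := by
      rw [← max_add_add_right]
      exact max_le_max (by linarith) h1
    linarith
  have htD : ∀ k < N + 1, u (t k) ∈ subdiffDom φ := by
    intro k hk
    cases k with
    | zero => rwa [ht0]
    | succ k => rw [hti k (by omega)]; exact hD k (by omega)
  refine ⟨N + 1, t, htm, ht0, htM, ?_⟩
  have hmain : ∀ k ∈ Finset.range (N + 1), (φ (u (t k))).toReal - (φ (u (t (k + 1)))).toReal ≤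
      (1 / 2 + δ * (1 / 2)) * (‖u (t (k + 1)) - u (t k)‖ ^ 2 / (t (k + 1) - t k)) +
        1 / 2 * (h * ‖subgrad φ (u (t k))‖ ^ 2) + δ * (1 / 2) * (t (k + 1) - t k) := by
    intro k hk
    have hk := Finset.mem_range.1 hk
    have hτ : 0 ≤ t (k + 1) - t k := sub_nonneg.2 (htm k.le_succ)
    have hτ0 : t (k + 1) - t k = 0 → ‖u (t (k + 1)) - u (t k)‖ = 0 := by
      intro h0
      rw [sub_eq_zero.1 h0]
      simp
    have hdist : ‖u (t (k + 1)) - u (t k)‖ < r := by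
      rw [← dist_eq_norm]
      refine huc _ (htI _ (by omega)) _ (htI _ hk.le) ?_
      rw [Real.dist_eq, abs_of_nonneg hτ]
      exact (hstep k).trans_lt hhρ
    have h1 := hconv (u (t k)) (u (t (k + 1))) _ (hc _ (htI _ hk.le)) (hc _ (htI _ (by omega)))
      (subgrad_mem (htD k hk)) hdist
    have h2 := (abs_le.1 (abs_real_inner_le_norm (subgrad φ (u (t k)))
      (u (t (k + 1)) - u (t k)))).1
    have h3 := mul_le_half_sq_div_add (y := ‖subgrad φ (u (t k))‖) hτ hτ0
    have h4 := mul_le_half_sq_div_add (y := 1) hτ hτ0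
    have h5 : (t (k + 1) - t k) * ‖subgrad φ (u (t k))‖ ^ 2 ≤ h * ‖subgrad φ (u (t k))‖ ^ 2 := by
      gcongr
      exact hstep k
    nlinarith
  have hshift : ∑ k ∈ Finset.range N, ‖subgrad φ (u (t (k + 1)))‖ ^ 2 =
      ∑ k ∈ Finset.range N, ‖subgrad φ (u (a + k * h + s))‖ ^ 2 :=
    Finset.sum_congr rfl fun k hk => by rw [hti k (Finset.mem_range.1 hk)]
  have hsumle := Finset.sum_le_sum hmain
  rw [Finset.sum_range_sub' (fun k => (φ (u (t k))).toReal), ht0, htM, Finset.sum_add_distrib,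
    Finset.sum_add_distrib, ← Finset.mul_sum, ← Finset.mul_sum, ← Finset.mul_sum, ← Finset.mul_sum,
    Finset.sum_range_sub (fun k => t k), ht0, htM,
    Finset.sum_range_succ' (fun k => ‖subgrad φ (u (t k))‖ ^ 2), ht0,
    hshift] at hsumle
  have hS' : h * ∑ k ∈ Finset.range N, ‖subgrad φ (u (a + k * h + s))‖ ^ 2 ≤ S := by
    rwa [le_div_iff₀ hh, mul_comm] at hsum
  have hCt := (hC (N + 1) t htm ht0 htM).trans (le_abs_self C)
  have hδC : δ * (|C| + (b - a)) = ε := by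
    simp only [δ]
    field_simp
  have := mul_le_mul_of_nonneg_left hCt hδ.le
  linarith

/-! ### Piecewise constant and piecewise affine interpolants. -/

lemma sum_indicator_Ioc {E : Type*} [AddCommMonoid E] {t : ℕ → ℝ} {n : ℕ}
    (ht : ∀ i < n, t i ≤ t (i + 1)) (x : ℕ → ℝ → E) {j : ℕ} (hj : j < n) {s : ℝ}
    (hs : s ∈ Ioc (t j) (t (j + 1))) :
    ∑ i ∈ Finset.range n, (Ioc (t i) (t (i + 1))).indicator (x i) s = x j s := by
  rw [Finset.sum_eq_single_of_mem j (Finset.mem_range.2 hj), indicator_of_mem hs]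
  intro i hi hij
  have hi := Finset.mem_range.1 hi
  refine indicator_of_notMem (fun h => ?_) _
  rcases lt_or_gt_of_ne hij with hlt | hlt
  · exact absurd (hs.1.trans_le h.2) (not_lt.2 (le_of_forall_lt_succ ht hlt (by omega)))
  · exact absurd (h.1.trans_le hs.2) (not_lt.2 (le_of_forall_lt_succ ht hlt (by omega)))

lemma exists_mem_Ioc_succ {t : ℕ → ℝ} {n : ℕ} {s : ℝ} (hs : s ∈ Ioc (t 0) (t n)) :
    ∃ j < n, s ∈ Ioc (t j) (t (j + 1)) := by
  induction n with
  | zero => simp at hs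
  | succ n ih =>
    by_cases h : s ≤ t n
    · obtain ⟨j, hj, hjs⟩ := ih ⟨hs.1, h⟩
      exact ⟨j, by omega, hjs⟩
    · exact ⟨n, by omega, not_le.1 h, hs.2⟩

namespace TimePartition

variable {T : ℝ} (P : TimePartition T)

/-- The piecewise constant function with value `c j` on `(t_j, t_{j+1}]`, zero outside `(0, T]`. -/
def stepInterp {E : Type*} [AddCommMonoid E] (c : ℕ → E) (s : ℝ) : E :=
  ∑ j ∈ Finset.range P.N, (Ioc (P.t j) (P.t (j + 1))).indicator (fun _ => c j) s

/-- The difference quotients of the values `w`. -/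
def velocity (w : ℕ → H) (j : ℕ) : H := (P.step j)⁻¹ • (w (j + 1) - w j)

lemma step_pos {j : ℕ} (hj : j < P.N) : 0 < P.step j := sub_pos.2 (P.t_lt j hj)

lemma t_le {i j : ℕ} (hij : i ≤ j) (hj : j ≤ P.N) : P.t i ≤ P.t j :=
  le_of_forall_lt_succ (fun i hi => (P.t_lt i hi).le) hij hj

lemma t_mem {j : ℕ} (hj : j ≤ P.N) : P.t j ∈ Icc 0 T :=
  ⟨P.t_zero.symm.le.trans (P.t_le j.zero_le hj), (P.t_le hj le_rfl).trans P.t_last.le⟩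

lemma step_le_fineness {j : ℕ} (hj : j < P.N) : P.step j ≤ P.fineness :=
  le_ciSup (f := fun i : Fin P.N => P.step i) (Set.finite_range _).bddAbove ⟨j, hj⟩

lemma exists_mem_Ioc {s : ℝ} (hs : s ∈ Ioc 0 T) :
    ∃ j < P.N, s ∈ Ioc (P.t j) (P.t (j + 1)) :=
  exists_mem_Ioc_succ (by rwa [P.t_zero, P.t_last])

lemma stepInterp_of_mem {E : Type*} [AddCommMonoid E] (c : ℕ → E) {j : ℕ} (hj : j < P.N) {s : ℝ}
    (hs : s ∈ Ioc (P.t j) (P.t (j + 1))) : P.stepInterp c s = c j :=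
  sum_indicator_Ioc (fun i hi => (P.t_lt i hi).le) (fun j _ => c j) hj hs

lemma stepInterp_of_notMem {E : Type*} [AddCommMonoid E] (c : ℕ → E) {s : ℝ}
    (hs : s ∉ Ioc 0 T) : P.stepInterp c s = 0 := by
  refine Finset.sum_eq_zero fun j hj => indicator_of_notMem (fun h => hs ?_) _
  have hj := Finset.mem_range.1 hj
  exact ⟨(P.t_mem hj.le).1.trans_lt h.1, h.2.trans (P.t_mem hj).2⟩

lemma memLp_stepInterp {E : Type*} [NormedAddCommGroup E] (c : ℕ → E) :
    MemLp (P.stepInterp c) 2 volume :=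
  memLp_finsetSum _ fun j _ => memLp_indicator_const 2 measurableSet_Ioc _ (Or.inr (by simp))

lemma integral_norm_sq_stepInterp {E : Type*} [NormedAddCommGroup E] (c : ℕ → E) :
    ∫ s, ‖P.stepInterp c s‖ ^ 2 = ∑ j ∈ Finset.range P.N, P.step j * ‖c j‖ ^ 2 := by
  have h : ∀ s, ‖P.stepInterp c s‖ ^ 2 = P.stepInterp (fun j => ‖c j‖ ^ 2) s := by
    intro s
    by_cases hs : s ∈ Ioc 0 T
    · obtain ⟨j, hj, hjs⟩ := P.exists_mem_Ioc hs
      rw [P.stepInterp_of_mem _ hj hjs, P.stepInterp_of_mem _ hj hjs]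
    · rw [P.stepInterp_of_notMem _ hs, P.stepInterp_of_notMem _ hs]
      simp
  simp only [h]
  unfold stepInterp
  rw [integral_finsetSum _ fun j _ => (integrable_indicator_iff measurableSet_Ioc).2 (by simp)]
  refine Finset.sum_congr rfl fun j hj => ?_
  have hj := Finset.mem_range.1 hj
  rw [integral_indicator_const _ measurableSet_Ioc, Real.volume_real_Ioc_of_le (P.t_lt j hj).le]
  rfl

lemma lintegral_stepInterp {E : Type*} [AddCommMonoid E] (c : ℕ → E) (f : E → ℝ≥0∞) :
    ∫⁻ s in Ioc 0 T, f (P.stepInterp c s) =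
      ∑ j ∈ Finset.range P.N, ENNReal.ofReal (P.step j) * f (c j) := by
  have := sum_lintegral_Ioc (fun i hi => (P.t_lt i hi).le) fun s => f (P.stepInterp c s)
  rw [P.t_zero, P.t_last] at this
  rw [← this]
  refine Finset.sum_congr rfl fun j hj => ?_
  rw [setLIntegral_congr_fun (g := fun _ => f (c j)) measurableSet_Ioc fun s hs => by
    simp only [P.stepInterp_of_mem c (Finset.mem_range.1 hj) hs]]
  rw [setLIntegral_const, Real.volume_Ioc, mul_comm]
  rfl

lemma integral_stepInterp [CompleteSpace H] (c : ℕ → H) {j : ℕ} (hj : j < P.N) {s : ℝ}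
    (hs : s ∈ Icc (P.t j) (P.t (j + 1))) :
    ∫ r in (P.t j)..s, P.stepInterp c r = (s - P.t j) • c j := by
  rw [← intervalIntegral.integral_const]
  refine intervalIntegral.integral_congr_ae (ae_of_all _ fun r hr => ?_)
  rw [uIoc_of_le hs.1] at hr
  exact P.stepInterp_of_mem c hj ⟨hr.1, hr.2.trans hs.2⟩

lemma integral_stepInterp_velocity [CompleteSpace H] (w : ℕ → H) {j : ℕ} (hj : j < P.N) {s : ℝ}
    (hs : s ∈ Icc (P.t j) (P.t (j + 1))) :
    ∫ r in (P.t j)..s, P.stepInterp (P.velocity w) r =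
      ((s - P.t j) / P.step j) • (w (j + 1) - w j) := by
  rw [P.integral_stepInterp _ hj hs, velocity, smul_smul, div_eq_mul_inv]

lemma primitive_velocity_node [CompleteSpace H] (w : ℕ → H) {j : ℕ} (hj : j ≤ P.N) :
    w 0 + ∫ r in (0 : ℝ)..(P.t j), P.stepInterp (P.velocity w) r = w j := by
  have hg := P.memLp_stepInterp (P.velocity w)
  induction j with
  | zero => simp [P.t_zero]
  | succ j ih =>
    rw [← intervalIntegral.integral_add_adjacent_intervals
      (intervalIntegrable_of_memLp hg 0 (P.t j)) (intervalIntegrable_of_memLp hg _ _),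
      ← add_assoc, ih (by omega), P.integral_stepInterp_velocity w hj
      (right_mem_Icc.2 (P.t_lt j hj).le), ← TimePartition.step, div_self (P.step_pos hj).ne',
      one_smul, add_sub_cancel]

/-- This reduces `H¹` statements about interpolants to `L²` statements about the step functions of
difference quotients. -/
lemma affineInterp_eq_primitive [CompleteSpace H] (w : ℕ → H) {s : ℝ} (hs : s ∈ Icc 0 T) :
    P.affineInterp w s = w 0 + ∫ r in (0 : ℝ)..s, P.stepInterp (P.velocity w) r := by
  have hg := P.memLp_stepInterp (P.velocity w)
  rcases hs.1.eq_or_lt with rfl | h0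
  · simp [affineInterp]
  obtain ⟨j, hj, hjs⟩ := P.exists_mem_Ioc ⟨h0, hs.2⟩
  rw [← intervalIntegral.integral_add_adjacent_intervals
    (intervalIntegrable_of_memLp hg 0 (P.t j)) (intervalIntegrable_of_memLp hg _ _),
    ← add_assoc, P.primitive_velocity_node w hj.le,
    P.integral_stepInterp_velocity w hj (Ioc_subset_Icc_self hjs), affineInterp,
    if_neg (not_le.2 h0),
    sum_indicator_Ioc (fun i hi => (P.t_lt i hi).le) _ hj hjs]
  module

lemma affineInterp_mem_convexHull (w : ℕ → H) {s : ℝ} (hs : s ∈ Ioc 0 T) {K : Set H}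
    (hK : ∀ j ≤ P.N, w j ∈ K) : P.affineInterp w s ∈ convexHull ℝ K := by
  obtain ⟨j, hj, hjs⟩ := P.exists_mem_Ioc hs
  rw [affineInterp, if_neg (not_le.2 hs.1),
    sum_indicator_Ioc (fun i hi => (P.t_lt i hi).le) _ hj hjs]
  have h0 := P.step_pos hj
  refine convex_convexHull ℝ K (subset_convexHull ℝ K (hK _ hj))
    (subset_convexHull ℝ K (hK _ hj.le))
    (div_nonneg (sub_nonneg.2 hjs.1.le) h0.le) (sub_nonneg.2 ?_) (by ring)
  rw [div_le_one h0]
  exact sub_le_sub_right hjs.2 _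

/-- The difference is the integral of the velocity from `s` to the next node, estimated by
Cauchy–Schwarz. -/
lemma norm_stepInterp_sub_affineInterp_le [CompleteSpace H] (w : ℕ → H) {s : ℝ} (hs : s ∈ Ioc 0 T) :
    ‖P.stepInterp (fun j => w (j + 1)) s - P.affineInterp w s‖ ≤
      √(P.fineness * ∫ r, ‖P.stepInterp (P.velocity w) r‖ ^ 2) := by
  have hg := P.memLp_stepInterp (P.velocity w)
  obtain ⟨j, hj, hjs⟩ := P.exists_mem_Ioc hs
  rw [P.stepInterp_of_mem _ hj hjs, P.affineInterp_eq_primitive w (Ioc_subset_Icc_self hs),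
    ← P.primitive_velocity_node w hj, add_sub_add_left_eq_sub,
    intervalIntegral.integral_interval_sub_left (intervalIntegrable_of_memLp hg _ _)
      (intervalIntegrable_of_memLp hg _ _)]
  refine (norm_integral_le_sqrt hg _ _).trans ?_
  gcongr
  rw [abs_of_nonneg (sub_nonneg.2 hjs.2)]
  have := P.step_le_fineness hj
  rw [step] at this
  linarith [hjs.1]

end TimePartition

/-! ### Compactness of the interpolants and strong convergence of the velocities. -/

/-- Primitives of a bounded sequence in `L²` with values in a compact set subconverge uniformly. -/
lemma exists_subseq_tendstoUniformlyOn_primitive {T : ℝ} (hT : 0 ≤ T) {K : Set H}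
    (hK : IsCompact K) {v : ℕ → ℝ → H} (hv : ∀ n, MemLp (v n) 2 volume) {C : ℝ}
    (hC : ∀ n, ∫ s, ‖v n s‖ ^ 2 ≤ C) {c : H}
    (hvK : ∀ n, ∀ s ∈ Icc 0 T, c + ∫ r in (0 : ℝ)..s, v n r ∈ K) :
    ∃ (σ : ℕ → ℕ) (u : ℝ → H), StrictMono σ ∧ Continuous u ∧
      TendstoUniformlyOn (fun k s => c + ∫ r in (0 : ℝ)..s, v (σ k) r) u atTop (Icc 0 T) := by
  let f : ℕ → BoundedContinuousFunction (Icc 0 T) H := fun n =>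
    BoundedContinuousFunction.mkOfCompact
      ⟨fun s => c + ∫ r in (0 : ℝ)..s, v n r,
        (continuous_primitive_of_memLp (hv n) c).comp continuous_subtype_val⟩
  have heq : Equicontinuous fun n => (f n : Icc 0 T → H) := by
    -- The `L²` bound gives a common Hölder modulus of exponent `1/2`.
    refine Metric.equicontinuous_of_continuity_modulus (fun d => √(d * C)) ?_ _ ?_
    · have : Continuous fun d : ℝ => √(d * C) := by fun_prop
      simpa using this.tendsto 0
    · intro x y n
      rw [dist_comm, dist_eq_norm]
      change ‖c + (∫ r in (0 : ℝ)..y, v n r) - (c + ∫ r in (0 : ℝ)..x, v n r)‖ ≤ _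
      rw [add_sub_add_left_eq_sub, intervalIntegral.integral_interval_sub_left
        (intervalIntegrable_of_memLp (hv n) _ _) (intervalIntegrable_of_memLp (hv n) _ _)]
      refine (norm_integral_le_sqrt (hv n) _ _).trans ?_
      rw [dist_comm, Subtype.dist_eq, Real.dist_eq]
      gcongr
      exact hC n
  have hcomp := BoundedContinuousFunction.arzela_ascoli K hK (range f)
    (by rintro _ x ⟨n, rfl⟩; exact hvK n x x.2) (by
      have h := heq
      intro x₀ U hU
      filter_upwards [h x₀ U hU] with x hx
      rintro ⟨_, n, rfl⟩
      exact hx n)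
  obtain ⟨g, -, σ, hσ, hg⟩ := hcomp.tendsto_subseq fun n => subset_closure (mem_range_self n)
  refine ⟨σ, IccExtend hT g, hσ, g.continuous.Icc_extend', ?_⟩
  have hu := BoundedContinuousFunction.tendsto_iff_tendstoUniformly.1 hg
  rw [Metric.tendstoUniformlyOn_iff]
  rw [Metric.tendstoUniformly_iff] at hu
  intro ε hε
  filter_upwards [hu ε hε] with k hk s hs
  rw [IccExtend_of_mem hT g hs]
  exact hk ⟨s, hs⟩

lemma norm_toLp_sq {g : ℝ → H} (hg : MemLp g 2 volume) :
    ‖hg.toLp g‖ ^ 2 = ∫ s, ‖g s‖ ^ 2 := by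
  rw [← real_inner_self_eq_norm_sq, L2.inner_def]
  refine integral_congr_ae ?_
  filter_upwards [hg.coeFn_toLp] with s hs
  rw [hs, real_inner_self_eq_norm_sq]

/-- If the primitives of `v n` converge to `u`, and the `L²` norms of the `v n` do not exceed the
action of `u` in the limit, then the `v n` converge strongly in `L²`. -/
lemma exists_tendsto_of_action_bound [CompleteSpace H] {T : ℝ} {v : ℕ → ℝ → H}
    (hv : ∀ n, MemLp (v n) 2 volume) {c : H} {u : ℝ → H}
    (hu : ∀ s ∈ Icc 0 T, Tendsto (fun n => c + ∫ r in (0 : ℝ)..s, v n r) atTop (𝓝 (u s)))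
    (hact : ∀ ε > 0, ∃ (M : ℕ) (t : ℕ → ℝ), Monotone t ∧ t 0 = 0 ∧ t M = T ∧ ∀ᶠ n in atTop,
      ∫ s, ‖v n s‖ ^ 2 ≤
        ∑ i ∈ Finset.range M, ‖u (t (i + 1)) - u (t i)‖ ^ 2 / (t (i + 1) - t i) + ε) :
    ∃ v' : ℝ → H, MemLp v' 2 volume ∧
      Tendsto (fun n => eLpNorm (v n - v') 2 volume) atTop (𝓝 0) ∧
      (∀ s ∈ Icc 0 T, u s = c + ∫ r in (0 : ℝ)..s, v' r) ∧
      Tendsto (fun n => ∫ s, ‖v n s‖ ^ 2) atTop (𝓝 (∫ s, ‖v' s‖ ^ 2)) := by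
  let V : ℕ → Lp H 2 (volume : Measure ℝ) := fun n => (hv n).toLp (v n)
  have hcauchy : CauchySeq V := by
    rw [cauchySeq_iff_tendsto_dist_atTop_0, ← prod_atTop_atTop_eq]
    rw [Metric.tendsto_nhds]
    intro η hη
    -- With `A` the partition sum of `u`, eventually `‖V p‖²` and `‖V q‖²` are at most `A + η²/6`,
    -- while `‖V p + V q‖²` exceeds `4 A - η²/6` by Jensen on the partition. The parallelogram law
    -- leaves `‖V p - V q‖² ≤ 5 η²/6`.
    obtain ⟨M, t, htm, ht0, htM, hle⟩ := hact (η ^ 2 / 6) (by positivity)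
    set A := ∑ i ∈ Finset.range M, ‖u (t (i + 1)) - u (t i)‖ ^ 2 / (t (i + 1) - t i)
    have htI : ∀ i ≤ M, t i ∈ Icc 0 T := fun i hi =>
      ⟨ht0.symm.le.trans (htm i.zero_le), (htm hi).trans htM.le⟩
    have hinc : ∀ i < M, Tendsto (fun n => ∫ r in (t i)..(t (i + 1)), v n r) atTop
        (𝓝 (u (t (i + 1)) - u (t i))) := by
      intro i hi
      refine ((hu _ (htI (i + 1) hi)).sub (hu _ (htI i hi.le))).congr fun n => ?_
      rw [add_sub_add_left_eq_sub, intervalIntegral.integral_interval_sub_left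
        (intervalIntegrable_of_memLp (hv n) _ _) (intervalIntegrable_of_memLp (hv n) _ _)]
    have hlim : Tendsto (fun p : ℕ × ℕ => ∑ i ∈ Finset.range M,
        ‖∫ r in (t i)..(t (i + 1)), (v p.1 + v p.2) r‖ ^ 2 / (t (i + 1) - t i))
        (atTop ×ˢ atTop) (𝓝 (4 * A)) := by
      rw [Finset.mul_sum]
      refine tendsto_finsetSum _ fun i hi => ?_
      have hi := Finset.mem_range.1 hi
      have h1 := (((hinc i hi).comp tendsto_fst).add ((hinc i hi).comp
        (tendsto_snd (f := (atTop : Filter ℕ))))).norm.pow 2 |>.div_const (t (i + 1) - t i)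
      convert! h1 using 2
      · simp only [Function.comp, Pi.add_apply]
        rw [intervalIntegral.integral_add (intervalIntegrable_of_memLp (hv _) _ _)
          (intervalIntegrable_of_memLp (hv _) _ _)]
      · rw [← two_smul ℝ, norm_smul, mul_pow]
        norm_num
        ring
    have hlow := hlim.eventually (lt_mem_nhds (show 4 * A - η ^ 2 / 6 < 4 * A by
      have : 0 < η ^ 2 / 6 := by positivity
      linarith))
    filter_upwards [hlow, tendsto_fst.eventually hle, tendsto_snd.eventually hle] with p h1 h2 h3
    rw [Real.dist_0_eq_abs, abs_of_nonneg dist_nonneg, dist_eq_norm]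
    have h4 : 4 * A - η ^ 2 / 6 < ‖V p.1 + V p.2‖ ^ 2 := by
      have := sum_norm_integral_sq_le ((hv p.1).add (hv p.2)) (n := M)
        fun i _ => htm i.le_succ
      rw [← MemLp.toLp_add, norm_toLp_sq]
      refine h1.trans_le (this.trans (intervalIntegral_norm_sq_le ((hv p.1).add (hv p.2)) ?_))
      exact htm M.zero_le
    have h5 : ‖V p.1 + V p.2‖ ^ 2 + ‖V p.1 - V p.2‖ ^ 2 = 2 * (‖V p.1‖ ^ 2 + ‖V p.2‖ ^ 2) := by
      have := parallelogram_law_with_norm ℝ (V p.1) (V p.2)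
      simpa only [sq] using this
    rw [← norm_toLp_sq (hv p.1)] at h2
    rw [← norm_toLp_sq (hv p.2)] at h3
    change ‖V p.1‖ ^ 2 ≤ _ at h2
    change ‖V p.2‖ ^ 2 ≤ _ at h3
    refine lt_of_pow_lt_pow_left₀ 2 hη.le ?_
    have : 0 < η ^ 2 := by positivity
    linarith
  obtain ⟨V', hV'⟩ := cauchySeq_tendsto_of_complete hcauchy
  have hv' : MemLp V' 2 volume := Lp.memLp V'
  have hV'' : Tendsto V atTop (𝓝 (hv'.toLp V')) := by rwa [Lp.toLp_coeFn]
  refine ⟨V', hv', (Lp.tendsto_Lp_iff_tendsto_eLpNorm'' v hv V' hv').1 hV'', fun s hs => ?_, ?_⟩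
  · refine tendsto_nhds_unique (hu s hs) ?_
    have h0 : Tendsto (fun n => √(|s - 0| * ‖V n - hv'.toLp V'‖ ^ 2)) atTop (𝓝 0) := by
      have h1 := (tendsto_iff_norm_sub_tendsto_zero.1 hV'').pow 2 |>.const_mul |s - 0|
      simpa using h1.sqrt
    rw [tendsto_iff_norm_sub_tendsto_zero]
    refine squeeze_zero (fun _ => norm_nonneg _) (fun n => ?_) h0
    rw [add_sub_add_left_eq_sub, ← intervalIntegral.integral_sub
      (intervalIntegrable_of_memLp (hv n) _ _) (intervalIntegrable_of_memLp hv' _ _),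
      ← MemLp.toLp_sub, norm_toLp_sq]
    exact norm_integral_le_sqrt ((hv n).sub hv') 0 s
  · have := hV''.norm.pow 2
    rw [norm_toLp_sq] at this
    exact this.congr fun n => norm_toLp_sq (hv n)

/-! ### The chain rule inequality and the identification of the limit. -/

/-- Chain rule inequality along a primitive of an `L²` function. -/
lemma IsRegularEnergy.sub_le_integral {φ : H → EReal} (hφ : IsRegularEnergy φ) {T : ℝ}
    {u v : ℝ → H} (hu : Continuous u) (hv : MemLp v 2 volume)
    {c : H} (huv : ∀ s ∈ Icc 0 T, u s = c + ∫ r in (0 : ℝ)..s, v r) {E : ℝ}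
    (hE : ∀ s ∈ Icc 0 T, φ (u s) ≤ E) {F : ℝ → ℝ} (hF : Integrable F) (hF0 : ∀ s, 0 ≤ F s)
    (hFs : ∀ᵐ s ∂volume.restrict (Ioc 0 T), slope φ (u s) ^ 2 = ENNReal.ofReal (F s))
    {a b : ℝ} (ha : 0 ≤ a) (hab : a ≤ b) (hb : b ≤ T) (hua : u a ∈ subdiffDom φ) :
    (φ (u a)).toReal - (φ (u b)).toReal ≤
      ∫ s in a..b, (1 / 2 * ‖v s‖ ^ 2 + 1 / 2 * F s) := by
  rcases hab.eq_or_lt with rfl | hab'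
  · simp
  have hsub : ∀ (M : ℕ) (t : ℕ → ℝ), Monotone t → t 0 = a → t M = b →
      ∑ i ∈ Finset.range M, ‖u (t (i + 1)) - u (t i)‖ ^ 2 / (t (i + 1) - t i) ≤
        ∫ s in a..b, ‖v s‖ ^ 2 := by
    intro M t htm ht0 htM
    have htI : ∀ i ≤ M, t i ∈ Icc 0 T := fun i hi =>
      ⟨ha.trans (ht0.symm.le.trans (htm i.zero_le)), ((htm hi).trans htM.le).trans hb⟩
    have := sum_norm_integral_sq_le hv (n := M) fun i _ => htm i.le_succ
    rw [ht0, htM] at this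
    refine le_trans (le_of_eq (Finset.sum_congr rfl fun i hi => ?_)) this
    have hi := Finset.mem_range.1 hi
    rw [huv _ (htI _ hi), huv _ (htI _ hi.le), add_sub_add_left_eq_sub,
      intervalIntegral.integral_interval_sub_left (intervalIntegrable_of_memLp hv _ _)
        (intervalIntegrable_of_memLp hv _ _)]
  have hS : ∫⁻ s in Ioc a b, slope φ (u s) ^ 2 ≤ ENNReal.ofReal (∫ s in a..b, F s) := by
    rw [intervalIntegral.integral_of_le hab,
      ofReal_integral_eq_lintegral_ofReal hF.integrableOn (ae_of_all _ hF0)]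
    exact (lintegral_congr_ae (ae_mono (Measure.restrict_mono (Ioc_subset_Ioc ha hb) le_rfl)
      hFs)).le
  rw [intervalIntegral.integral_add ((integrable_norm_sq hv).const_mul _).intervalIntegrable
    (hF.const_mul _).intervalIntegrable, intervalIntegral.integral_const_mul,
    intervalIntegral.integral_const_mul]
  refine le_of_forall_pos_le_add fun ε hε => ?_
  obtain ⟨M, t, htm, ht0, htM, hle⟩ := hφ.exists_partition_le hu hab'
    (fun s hs => hE s ⟨ha.trans hs.1, hs.2.trans hb⟩) hua
    (intervalIntegral.integral_nonneg hab fun s _ => hF0 s) hS hsub hε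
  have := hsub M t htm ht0 htM
  linarith

/-- A curve that satisfies the energy inequality on `[0, T]` solves the gradient flow. -/
lemma IsRegularEnergy.ae_neg_mem_subdiff {φ : H → EReal} (hφ : IsRegularEnergy φ)
    [CompleteSpace H] {T : ℝ}
    (hT : 0 < T) {u v : ℝ → H} (hu : Continuous u) (hv : MemLp v 2 volume)
    {c : H} (huv : ∀ s ∈ Icc 0 T, u s = c + ∫ r in (0 : ℝ)..s, v r) {E : ℝ}
    (hE : ∀ s ∈ Icc 0 T, φ (u s) ≤ E) (hu0 : u 0 ∈ subdiffDom φ)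
    (hfin : ∫⁻ s in Ioc 0 T, slope φ (u s) ^ 2 ≠ ⊤)
    (hineq : (φ (u T)).toReal + 1 / 2 * (∫ s in (0 : ℝ)..T, ‖v s‖ ^ 2) +
      1 / 2 * (∫⁻ s in Ioc 0 T, slope φ (u s) ^ 2).toReal ≤ (φ (u 0)).toReal) :
    ∀ᵐ s ∂volume.restrict (Ioo 0 T), -(v s) ∈ subdiff φ (u s) := by
  have hmeas := hφ.measurable_slope_sq hu
  set F : ℝ → ℝ := (Ioc 0 T).indicator fun s => (slope φ (u s) ^ 2).toReal
  have hF0 : ∀ s, 0 ≤ F s := fun s => indicator_nonneg (fun _ _ => ENNReal.toReal_nonneg) s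
  have hF : Integrable F := by
    rw [integrable_indicator_iff measurableSet_Ioc]
    exact integrable_toReal_of_lintegral_ne_top hmeas.aemeasurable hfin
  have hae : ∀ᵐ s ∂volume.restrict (Ioc 0 T), slope φ (u s) ^ 2 < ⊤ :=
    ae_lt_top hmeas hfin
  have hFs : ∀ᵐ s ∂volume.restrict (Ioc 0 T), slope φ (u s) ^ 2 = ENNReal.ofReal (F s) := by
    filter_upwards [hae, self_mem_ae_restrict measurableSet_Ioc] with s hs hsI
    simp only [F]
    rw [indicator_of_mem hsI, ENNReal.ofReal_toReal hs.ne]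
  have hFint : (∫⁻ s in Ioc 0 T, slope φ (u s) ^ 2).toReal = ∫ s in (0 : ℝ)..T, F s := by
    rw [intervalIntegral.integral_of_le hT.le, ← integral_toReal hmeas.aemeasurable hae]
    exact setIntegral_congr_fun measurableSet_Ioc fun s hs => by
      simp only [F]; rw [indicator_of_mem hs]
  set g : ℝ → ℝ := fun s => 1 / 2 * ‖v s‖ ^ 2 + 1 / 2 * F s
  have hg : Integrable g := ((integrable_norm_sq hv).const_mul _).add (hF.const_mul _)
  have hgi : ∀ a b, IntervalIntegrable g volume a b := fun a b => hg.intervalIntegrable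
  set G : ℝ → ℝ := fun s => ∫ r in (0 : ℝ)..s, g r
  have hGc : Continuous G := intervalIntegral.continuous_primitive hgi 0
  have hGT : G T = 1 / 2 * (∫ s in (0 : ℝ)..T, ‖v s‖ ^ 2) + 1 / 2 * ∫ s in (0 : ℝ)..T, F s := by
    simp only [G, g]
    rw [intervalIntegral.integral_add ((integrable_norm_sq hv).const_mul _).intervalIntegrable
      (hF.const_mul _).intervalIntegrable, intervalIntegral.integral_const_mul,
      intervalIntegral.integral_const_mul]
  -- The chain rule inequalities on `[0, s]` and `[s, T]` add up to the reverse of the assumed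
  -- energy inequality, so both are equalities.
  have hid : ∀ s ∈ Ioo 0 T, u s ∈ subdiffDom φ → (φ (u s)).toReal = (φ (u 0)).toReal - G s := by
    intro s hs hsD
    have h1 := hφ.sub_le_integral hu hv huv hE hF hF0 hFs le_rfl hs.1.le hs.2.le hu0
    have h2 := hφ.sub_le_integral hu hv huv hE hF hF0 hFs hs.1.le hs.2.le le_rfl hsD
    have h3 : G s + ∫ r in s..T, g r = G T :=
      intervalIntegral.integral_add_adjacent_intervals (hgi _ _) (hgi _ _)
    change _ ≤ G s at h1
    change _ ≤ ∫ r in s..T, g r at h2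
    rw [hFint] at hineq
    linarith
  have hDae : ∀ᵐ s, s ∈ Ioc 0 T → u s ∈ subdiffDom φ := by
    rw [← ae_restrict_iff' measurableSet_Ioc]
    filter_upwards [hae] with s hs
    refine mem_subdiffDom_of_slope_lt_top ?_
    by_contra hcon
    rw [not_lt, top_le_iff] at hcon
    simp [hcon] at hs
  have hdense := Measure.dense_of_ae hDae
  rw [ae_restrict_iff' measurableSet_Ioo]
  filter_upwards [hDae, LocallyIntegrable.ae_hasDerivAt_integral hg.locallyIntegrable,
    (intervalIntegrable_of_memLp hv 0 T).ae_hasDerivAt_integral] with s hsD hGd hvd hs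
  have hsI := Ioo_subset_Icc_self hs
  replace hsD := hsD (Ioo_subset_Ioc_self hs)
  replace hGd : HasDerivAt G (g s) s := hGd 0
  replace hvd := hvd (by rwa [uIcc_of_le hT.le]) 0 (by simp)
  have hud : HasDerivAt u (v s) s := by
    refine (hvd.const_add c).congr_of_eventuallyEq ?_
    filter_upwards [Ioo_mem_nhds hs.1 hs.2] with x hx using huv x (Ioo_subset_Icc_self hx)
  set ξ := subgrad φ (u s)
  have hFs : F s = ‖ξ‖ ^ 2 := by
    simp only [F]
    rw [indicator_of_mem (Ioo_subset_Ioc_self hs), hφ.slope_sq_eq hsD,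
      ENNReal.toReal_ofReal (by positivity)]
  -- The energy along `u` equals `φ(u(0)) - G` only where `u` lies in the domain, a dense set of
  -- times. Replacing it by the continuous function `-G` extends the subgradient inequality to all
  -- nearby times.
  have hlow : ∀ δ > 0, ∀ᶠ x in 𝓝 s, 0 ≤ -(G x - G s) - inner ℝ ξ (u x - u s) +
      δ * ‖u x - u s‖ := by
    intro δ hδ
    obtain ⟨r, hr, hconv⟩ := hφ.almost_convex E δ hδ
    have hV : IsOpen (Ioo 0 T ∩ u ⁻¹' Metric.ball (u s) r) :=
      isOpen_Ioo.inter (Metric.isOpen_ball.preimage hu)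
    filter_upwards [hV.mem_nhds ⟨hs, Metric.mem_ball_self hr⟩] with x hx
    have hcl : IsClosed {x | 0 ≤ -(G x - G s) - inner ℝ ξ (u x - u s) + δ * ‖u x - u s‖} :=
      isClosed_le continuous_const (by fun_prop)
    refine closure_minimal ?_ hcl (hdense.open_subset_closure_inter hV hx)
    rintro y ⟨⟨hyI, hyr⟩, hyD⟩
    have h1 := hconv (u s) (u y) ξ (hE s hsI) (hE y (Ioo_subset_Icc_self hyI)) (subgrad_mem hsD)
      (by rw [← dist_eq_norm]; exact hyr)
    have h2 := hid s hs hsD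
    have h3 := hid y hyI (hyD (Ioo_subset_Ioc_self hyI))
    simp only [mem_ofPred_eq]
    linarith
  have hder : HasDerivAt (fun x => -(G x) - inner ℝ ξ (u x)) (-(g s) - inner ℝ ξ (v s)) s :=
    hGd.neg.sub (by simpa using (hasDerivAt_const s ξ).inner ℝ hud)
  have hshift : Tendsto (fun t : ℝ => s + t) (𝓝 0) (𝓝 s) := by
    have : Continuous fun t : ℝ => s + t := by fun_prop
    simpa using this.tendsto 0
  have hr : ∀ δ > 0, 0 ≤ -(g s) - inner ℝ ξ (v s) + δ * ‖v s‖ := by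
    intro δ hδ
    refine ge_of_tendsto (hder.tendsto_slope_zero_right.add
      (hud.tendsto_slope_zero_right.norm.const_mul δ)) ?_
    filter_upwards [nhdsWithin_le_nhds (hshift.eventually (hlow δ hδ)), self_mem_nhdsWithin]
      with t ht ht0
    have ht0 : 0 < t := ht0
    rw [norm_smul, Real.norm_eq_abs, abs_of_pos (inv_pos.2 ht0), smul_eq_mul]
    have := mul_nonneg (inv_pos.2 ht0).le ht
    rw [inner_sub_right] at this
    linarith
  have hl : ∀ δ > 0, -(g s) - inner ℝ ξ (v s) - δ * ‖v s‖ ≤ 0 := by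
    intro δ hδ
    refine le_of_tendsto (hder.tendsto_slope_zero_left.sub
      (hud.tendsto_slope_zero_left.norm.const_mul δ)) ?_
    filter_upwards [nhdsWithin_le_nhds (hshift.eventually (hlow δ hδ)), self_mem_nhdsWithin]
      with t ht ht0
    have ht0 : t < 0 := ht0
    rw [norm_smul, Real.norm_eq_abs, abs_of_neg (inv_lt_zero.2 ht0), smul_eq_mul]
    have := mul_nonpos_of_nonpos_of_nonneg (inv_lt_zero.2 ht0).le ht
    rw [inner_sub_right] at this
    linarith
  -- Right and left difference quotients of the same inequality give opposite signs, and `δ` tends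
  -- to `0`.
  have h0 : g s + inner ℝ ξ (v s) = 0 := by
    refine le_antisymm ?_ ?_
    · refine le_of_forall_pos_le_add fun ε hε => ?_
      have := hr (ε / (‖v s‖ + 1)) (by positivity)
      have h2 : ε / (‖v s‖ + 1) * ‖v s‖ ≤ ε := by
        rw [div_mul_eq_mul_div, div_le_iff₀ (by positivity)]
        nlinarith
      linarith
    · refine le_of_forall_pos_le_add fun ε hε => ?_
      have := hl (ε / (‖v s‖ + 1)) (by positivity)
      have h2 : ε / (‖v s‖ + 1) * ‖v s‖ ≤ ε := by
        rw [div_mul_eq_mul_div, div_le_iff₀ (by positivity)]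
        nlinarith
      linarith
  -- Here `g s = (‖v s‖² + ‖ξ‖²) / 2`, so `h0` is half a complete square.
  have hsq : ‖ξ + v s‖ ^ 2 = 0 := by
    rw [norm_add_sq_real]
    simp only [g] at h0
    rw [hFs] at h0
    linarith
  have hξ : -(v s) = ξ := by
    have := norm_eq_zero.1 (pow_eq_zero_iff two_ne_zero |>.1 hsq)
    exact (eq_neg_of_add_eq_zero_left this).symm
  rw [hξ]
  exact subgrad_mem hsD

/-! ### Convergence of values with vanishing residual. -/

lemma residual_nonneg {T : ℝ} (φ : H → EReal) (P : TimePartition T) (w : ℕ → H) :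
    0 ≤ residual φ P w := Finset.sum_nonneg fun _ _ => le_max_right _ _

/-- The discrete energy inequality. -/
lemma energy_add_le_residual {T : ℝ} (φ : H → EReal) (P : TimePartition T) (w : ℕ → H) {k : ℕ}
    (hk : k ≤ P.N) :
    (φ (w k)).toReal + 1 / 2 * ∑ i ∈ Finset.range k, P.step i * ‖P.velocity w i‖ ^ 2 +
      1 / 2 * ∑ i ∈ Finset.range k, P.step i * ‖subgrad φ (w (i + 1))‖ ^ 2 ≤
      (φ (w 0)).toReal + residual φ P w := by
  have h1 : ∑ i ∈ Finset.range k, G φ (P.step i) (w (i + 1)) (w i) ≤ residual φ P w := by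
    refine (Finset.sum_le_sum fun i _ => le_max_left _ 0).trans ?_
    exact Finset.sum_le_sum_of_subset_of_nonneg (Finset.range_subset_range.2 hk)
      fun _ _ _ => le_max_right _ _
  have h2 : ∀ i, G φ (P.step i) (w (i + 1)) (w i) =
      ((φ (w (i + 1))).toReal - (φ (w i)).toReal) + (1 / 2 * (P.step i * ‖P.velocity w i‖ ^ 2) +
        1 / 2 * (P.step i * ‖subgrad φ (w (i + 1))‖ ^ 2)) := by
    intro i
    rw [G, TimePartition.velocity]
    ring
  simp only [h2] at h1
  rw [Finset.sum_add_distrib, Finset.sum_range_sub (fun i => (φ (w i)).toReal),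
    Finset.sum_add_distrib, ← Finset.mul_sum, ← Finset.mul_sum] at h1
  linarith

namespace IsRegularEnergy

lemma exists_le_toReal {φ : H → EReal} (hφ : IsRegularEnergy φ) {u₀ : H} (hu₀ : φ u₀ ≠ ⊤) :
    ∃ m : ℝ, ∀ u, φ u ≠ ⊤ → m ≤ (φ u).toReal := by
  have h0 := EReal.coe_toReal hu₀ (hφ.ne_bot u₀)
  obtain ⟨x, hx, hmin⟩ := (hφ.lsc.lowerSemicontinuousOn _).exists_isMinOn
    ⟨u₀, h0.ge⟩ (hφ.compact (φ u₀).toReal)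
  have hx : φ x ≤ ((φ u₀).toReal : EReal) := hx
  refine ⟨(φ x).toReal, fun u hu => EReal.toReal_le_toReal ?_ (hφ.ne_bot x) hu⟩
  rcases le_total (φ u) (φ u₀) with h | h
  · exact hmin (h.trans h0.ge)
  · exact (hx.trans h0.le).trans h

lemma le_coe {φ : H → EReal} (hφ : IsRegularEnergy φ) {u : H} (hu : φ u ≠ ⊤) {c : ℝ}
    (h : (φ u).toReal ≤ c) : φ u ≤ c := by
  rw [← EReal.coe_toReal hu (hφ.ne_bot u)]
  exact_mod_cast h

/-- Sublevels of `φ` need not be convex, so affine interpolants may leave them; the closed convex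
hull is still compact. -/
lemma isCompact_closure_convexHull_sublevel [CompleteSpace H] {φ : H → EReal}
    (hφ : IsRegularEnergy φ) (c : ℝ) :
    IsCompact (closure (convexHull ℝ {u | φ u ≤ (c : EReal)})) :=
  isCompact_iff_totallyBounded_isComplete.2
    ⟨(hφ.compact c).totallyBounded.convexHull.closure, isClosed_closure.isComplete⟩

lemma eventually_sub_lt_toReal {φ : H → EReal} (hφ : IsRegularEnergy φ) {x : ℕ → H} {y : H}
    (hx : Tendsto x atTop (𝓝 y)) (hxt : ∀ n, φ (x n) ≠ ⊤) (hy : φ y ≠ ⊤) {ε : ℝ} (hε : 0 < ε) :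
    ∀ᶠ n in atTop, (φ y).toReal - ε < (φ (x n)).toReal := by
  have : (((φ y).toReal - ε : ℝ) : EReal) < φ y := by
    conv_rhs => rw [← EReal.coe_toReal hy (hφ.ne_bot y)]
    exact_mod_cast sub_lt_self _ hε
  filter_upwards [hx.eventually (hφ.lsc y _ this)] with n hn
  rw [← EReal.coe_toReal (hxt n) (hφ.ne_bot _)] at hn
  exact_mod_cast hn

/-- Lower semicontinuity of the integral of the squared slope along piecewise constant curves. -/
lemma lintegral_slope_sq_le_liminf {φ : H → EReal} (hφ : IsRegularEnergy φ) {T : ℝ}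
    {P : ℕ → TimePartition T} {w : ℕ → ℕ → H} {u : ℝ → H}
    (hw : ∀ s ∈ Ioc 0 T,
      Tendsto (fun n => (P n).stepInterp (fun j => w n (j + 1)) s) atTop (𝓝 (u s)))
    (hD : ∀ n, ∀ i ≤ (P n).N, w n i ∈ subdiffDom φ) :
    ∫⁻ s in Ioc 0 T, slope φ (u s) ^ 2 ≤ liminf (fun n => ENNReal.ofReal
      (∑ i ∈ Finset.range (P n).N, (P n).step i * ‖subgrad φ (w n (i + 1))‖ ^ 2)) atTop := by
  -- Fatou's lemma applies to these step functions; the slope is taken at the right node, as in `G`.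
  let F : ℕ → ℝ → ℝ≥0∞ := fun n => (P n).stepInterp fun j => slope φ (w n (j + 1)) ^ 2
  have hFm : ∀ n, Measurable (F n) := fun n =>
    Finset.measurable_fun_sum _ fun j _ => measurable_const.indicator measurableSet_Ioc
  have hFi : ∀ n, ∫⁻ s in Ioc 0 T, F n s = ENNReal.ofReal
      (∑ i ∈ Finset.range (P n).N, (P n).step i * ‖subgrad φ (w n (i + 1))‖ ^ 2) := by
    intro n
    rw [(P n).lintegral_stepInterp _ fun x => x, ENNReal.ofReal_sum_of_nonneg fun i hi =>
      mul_nonneg ((P n).step_pos (Finset.mem_range.1 hi)).le (by positivity)]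
    refine Finset.sum_congr rfl fun i hi => ?_
    have hi := Finset.mem_range.1 hi
    rw [hφ.slope_sq_eq (hD n _ hi), ENNReal.ofReal_mul ((P n).step_pos hi).le]
  have hlsc : LowerSemicontinuous fun x => slope φ x ^ 2 :=
    Continuous.comp_lowerSemicontinuous (g := fun y : ℝ≥0∞ => y ^ 2) (ENNReal.continuous_pow 2)
      hφ.slope_lsc fun a b hab => pow_le_pow_left' hab 2
  have hle : ∀ s ∈ Ioc 0 T, slope φ (u s) ^ 2 ≤ liminf (fun n => F n s) atTop := by
    intro s hs
    rw [le_liminf_iff]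
    intro y hy
    filter_upwards [(hw s hs).eventually (hlsc (u s) y hy)] with n hn
    obtain ⟨j, hj, hjs⟩ := (P n).exists_mem_Ioc hs
    rw [(P n).stepInterp_of_mem _ hj hjs] at hn
    simpa only [F, (P n).stepInterp_of_mem _ hj hjs] using hn
  calc ∫⁻ s in Ioc 0 T, slope φ (u s) ^ 2
      ≤ ∫⁻ s in Ioc 0 T, liminf (fun n => F n s) atTop :=
        setLIntegral_mono' measurableSet_Ioc hle
    _ ≤ liminf (fun n => ∫⁻ s in Ioc 0 T, F n s) atTop := lintegral_liminf_le hFm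
    _ = _ := by simp only [hFi]

end IsRegularEnergy

lemma eventually_sub_le_of_le_liminf {b : ℕ → ℝ} (hb : ∀ n, 0 ≤ b n) {S : ℝ≥0∞} (hS : S ≠ ⊤)
    (h : S ≤ liminf (fun n => ENNReal.ofReal (b n)) atTop) {ε : ℝ} (hε : 0 < ε) :
    ∀ᶠ n in atTop, S.toReal - ε ≤ b n := by
  rcases le_or_gt S.toReal 0 with h0 | h0
  · exact Eventually.of_forall fun n => by linarith [hb n]
  have : ENNReal.ofReal (S.toReal - ε) < S := by
    conv_rhs => rw [← ENNReal.ofReal_toReal hS]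
    exact (ENNReal.ofReal_lt_ofReal_iff h0).2 (by linarith)
  filter_upwards [eventually_lt_of_lt_liminf (this.trans_le h)] with n hn
  exact (ENNReal.ofReal_lt_ofReal_iff'.1 hn).1.le

lemma tendsto_eLpNorm_of_tendstoUniformlyOn {E : Type*} [NormedAddCommGroup E] {T : ℝ}
    {f : ℕ → ℝ → E} {u : ℝ → E}
    (h : TendstoUniformlyOn f u atTop (Icc 0 T)) :
    Tendsto (fun n => eLpNorm (f n - u) 2 (volume.restrict (Ioo 0 T))) atTop (𝓝 0) := by
  rw [ENNReal.tendsto_nhds_zero]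
  intro ε hε
  set M := (volume.restrict (Ioo 0 T)) univ ^ (2 : ℝ≥0∞).toReal⁻¹
  have hM : M ≠ ⊤ := ENNReal.rpow_ne_top_of_nonneg (by simp) (by simp)
  have hlim : Tendsto (fun δ : ℝ => M * ENNReal.ofReal δ) (𝓝[>] 0) (𝓝 0) := by
    have : Tendsto (fun δ : ℝ => M * ENNReal.ofReal δ) (𝓝 0) (𝓝 (M * ENNReal.ofReal 0)) :=
      ENNReal.Tendsto.const_mul (ENNReal.continuous_ofReal.tendsto 0) (Or.inr hM)
    simp only [ENNReal.ofReal_zero, mul_zero] at this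
    exact this.mono_left nhdsWithin_le_nhds
  obtain ⟨δ, hδε, hδ⟩ := ((hlim.eventually (eventually_le_nhds hε)).and self_mem_nhdsWithin).exists
  filter_upwards [Metric.tendstoUniformlyOn_iff.1 h δ hδ] with n hn
  refine (eLpNorm_le_of_ae_bound (C := δ) ?_).trans hδε
  refine (ae_restrict_iff' measurableSet_Ioo).2 (ae_of_all _ fun s hs => ?_)
  have := hn s (Ioo_subset_Icc_self hs)
  rw [dist_comm, dist_eq_norm] at this
  exact this.le

/-- Values with vanishing residual subconverge to a solution of the gradient flow. -/
theorem IsRegularEnergy.subconvergesToSolution [CompleteSpace H] {φ : H → EReal}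
    (hφ : IsRegularEnergy φ) {T : ℝ} (hT : 0 < T) {u₀ : H} (hu₀ : u₀ ∈ subdiffDom φ)
    {P : ℕ → TimePartition T} (hP : Tendsto (fun n => (P n).fineness) atTop (𝓝 0))
    {w : ℕ → ℕ → H} (hw0 : ∀ n, w n 0 = u₀) (hD : ∀ n, ∀ i ≤ (P n).N, w n i ∈ subdiffDom φ)
    (hres : Tendsto (fun n => residual φ (P n) (w n)) atTop (𝓝 0)) :
    SubconvergesToSolution φ T u₀ P w := by
  have htop : ∀ {x}, x ∈ subdiffDom φ → φ x ≠ ⊤ := fun ⟨ξ, hξ⟩ => hξ.1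
  obtain ⟨R, hR⟩ := hres.bddAbove_range
  replace hR : ∀ n, residual φ (P n) (w n) ≤ R := fun n => hR (mem_range_self n)
  obtain ⟨m, hm⟩ := hφ.exists_le_toReal (htop hu₀)
  set E₀ := (φ u₀).toReal
  have hR0 : 0 ≤ R := (residual_nonneg φ (P 0) (w 0)).trans (hR 0)
  let v : ℕ → ℝ → H := fun n => (P n).stepInterp ((P n).velocity (w n))
  have hv : ∀ n, MemLp (v n) 2 volume := fun n => (P n).memLp_stepInterp _
  have hvsq : ∀ n, ∫ s, ‖v n s‖ ^ 2 =
      ∑ i ∈ Finset.range (P n).N, (P n).step i * ‖(P n).velocity (w n) i‖ ^ 2 :=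
    fun n => (P n).integral_norm_sq_stepInterp _
  let B : ℕ → ℝ := fun n =>
    ∑ i ∈ Finset.range (P n).N, (P n).step i * ‖subgrad φ (w n (i + 1))‖ ^ 2
  have hstep0 : ∀ n k, k ≤ (P n).N → ∀ a : ℕ → ℝ,
      0 ≤ ∑ i ∈ Finset.range k, (P n).step i * a i ^ 2 := fun n k hk a =>
    Finset.sum_nonneg fun i hi =>
      mul_nonneg ((P n).step_pos ((Finset.mem_range.1 hi).trans_le hk)).le (sq_nonneg _)
  have hB0 : ∀ n, 0 ≤ B n := fun n => hstep0 n _ le_rfl _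
  have hdisc : ∀ n, (φ (w n (P n).N)).toReal + 1 / 2 * (∫ s, ‖v n s‖ ^ 2) + 1 / 2 * B n ≤
      E₀ + residual φ (P n) (w n) := by
    intro n
    have := energy_add_le_residual φ (P n) (w n) le_rfl
    rwa [hw0, ← hvsq] at this
  have hK : ∀ n, ∀ i ≤ (P n).N, φ (w n i) ≤ ((E₀ + R : ℝ) : EReal) := by
    intro n i hi
    refine hφ.le_coe (htop (hD n i hi)) ?_
    have h1 := energy_add_le_residual φ (P n) (w n) hi
    rw [hw0] at h1
    have h2 := hstep0 n i hi fun i => ‖(P n).velocity (w n) i‖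
    have h3 := hstep0 n i hi fun i => ‖subgrad φ (w n (i + 1))‖
    linarith [hR n]
  set C := 2 * (E₀ + R - m)
  have hsqnn : ∀ n, 0 ≤ ∫ s, ‖v n s‖ ^ 2 := fun n => integral_nonneg fun s => by positivity
  have hvC : ∀ n, ∫ s, ‖v n s‖ ^ 2 ≤ C := fun n => by
    linarith [hdisc n, hR n, hB0 n, hm _ (htop (hD n _ le_rfl))]
  have hBC : ∀ n, B n ≤ C := fun n => by
    linarith [hdisc n, hR n, hsqnn n, hm _ (htop (hD n _ le_rfl))]
  have hprim : ∀ n, ∀ s ∈ Icc 0 T, (P n).affineInterp (w n) s = u₀ + ∫ r in (0 : ℝ)..s, v n r :=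
    fun n s hs => by rw [(P n).affineInterp_eq_primitive (w n) hs, hw0]
  obtain ⟨σ, u, hσ, hu, hunif⟩ := exists_subseq_tendstoUniformlyOn_primitive hT.le
    (hφ.isCompact_closure_convexHull_sublevel (E₀ + R)) hv hvC (c := u₀) (by
      intro n s hs
      rw [← hprim n s hs]
      refine subset_closure ?_
      rcases hs.1.eq_or_lt with rfl | hs0
      · rw [hprim n 0 hs, intervalIntegral.integral_same, add_zero, ← hw0 n]
        exact subset_convexHull ℝ _ (hK n 0 (Nat.zero_le _))
      · exact (P n).affineInterp_mem_convexHull (w n) ⟨hs0, hs.2⟩ (hK n))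
  have hptw : ∀ s ∈ Icc 0 T, Tendsto (fun k => u₀ + ∫ r in (0 : ℝ)..s, v (σ k) r) atTop
      (𝓝 (u s)) := fun s hs => hunif.tendsto_at hs
  have hu0 : u 0 = u₀ := by
    have := hptw 0 (left_mem_Icc.2 hT.le)
    simp only [intervalIntegral.integral_same, add_zero] at this
    exact tendsto_nhds_unique this tendsto_const_nhds
  -- On `(0, T]` the step interpolants take only the values `w`, where energy and slope are
  -- controlled. They share the limit of the affine ones, which transfers both bounds to `u`.
  have hstep : ∀ s ∈ Ioc 0 T, Tendsto
      (fun k => (P (σ k)).stepInterp (fun j => w (σ k) (j + 1)) s) atTop (𝓝 (u s)) := by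
    intro s hs
    have h0 : Tendsto (fun k => √((P (σ k)).fineness * C)) atTop (𝓝 0) := by
      simpa using ((hP.comp hσ.tendsto_atTop).mul_const C).sqrt
    have h1 : Tendsto (fun k => (P (σ k)).stepInterp (fun j => w (σ k) (j + 1)) s -
        (u₀ + ∫ r in (0 : ℝ)..s, v (σ k) r)) atTop (𝓝 0) := by
      refine squeeze_zero_norm (fun k => ?_) h0
      rw [← hprim _ s (Ioc_subset_Icc_self hs)]
      refine ((P (σ k)).norm_stepInterp_sub_affineInterp_le (w (σ k)) hs).trans ?_
      obtain ⟨j, hj, -⟩ := (P (σ k)).exists_mem_Ioc hs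
      have hf : 0 ≤ (P (σ k)).fineness :=
        ((P (σ k)).step_pos hj).le.trans ((P (σ k)).step_le_fineness hj)
      gcongr
      exact hvC (σ k)
    simpa using h1.add (hptw s (Ioc_subset_Icc_self hs))
  have huK : ∀ s ∈ Icc 0 T, φ (u s) ≤ ((E₀ + R : ℝ) : EReal) := by
    intro s hs
    rcases hs.1.eq_or_lt with rfl | hs0
    · rw [hu0]
      exact hφ.le_coe (htop hu₀) (by linarith)
    · refine (hφ.compact (E₀ + R)).isClosed.mem_of_tendsto (hstep s ⟨hs0, hs.2⟩)
        (Eventually.of_forall fun k => ?_)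
      obtain ⟨j, hj, hjs⟩ := (P (σ k)).exists_mem_Ioc ⟨hs0, hs.2⟩
      rw [(P (σ k)).stepInterp_of_mem _ hj hjs]
      exact hK _ _ hj
  have hTmem : T ∈ Icc 0 T := right_mem_Icc.2 hT.le
  have huT : φ (u T) ≠ ⊤ := ne_top_of_le_ne_top (EReal.coe_ne_top _) (huK T hTmem)
  set S := ∫⁻ s in Ioc 0 T, slope φ (u s) ^ 2
  have hSlim : S ≤ liminf (fun k => ENNReal.ofReal (B (σ k))) atTop :=
    hφ.lintegral_slope_sq_le_liminf (P := fun k => P (σ k)) (w := fun k => w (σ k)) hstep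
      fun k => hD (σ k)
  have hStop : S ≠ ⊤ := by
    refine ne_top_of_le_ne_top ENNReal.ofReal_ne_top (hSlim.trans (?_ : _ ≤ ENNReal.ofReal C))
    refine liminf_le_of_frequently_le' (Eventually.of_forall fun k => ?_).frequently
    exact ENNReal.ofReal_le_ofReal (hBC _)
  -- The discrete energy inequality doubled: the errors in the final energy and the residual count
  -- twice, that of the slope integral once, hence the fifths of `ε`.
  have hup : ∀ ε > 0, ∀ᶠ k in atTop,
      ∫ s, ‖v (σ k) s‖ ^ 2 ≤ 2 * (E₀ - (φ (u T)).toReal) - S.toReal + ε := by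
    intro ε hε
    have hwT : Tendsto (fun k => w (σ k) (P (σ k)).N) atTop (𝓝 (u T)) := by
      refine (hptw T hTmem).congr fun k => ?_
      have := (P (σ k)).primitive_velocity_node (w (σ k)) le_rfl
      rwa [(P (σ k)).t_last, hw0] at this
    filter_upwards [hφ.eventually_sub_lt_toReal hwT (fun k => htop (hD _ _ le_rfl)) huT
      (by positivity : 0 < ε / 5), eventually_sub_le_of_le_liminf (fun k => hB0 (σ k)) hStop hSlim
      (by positivity : 0 < ε / 5), (hres.comp hσ.tendsto_atTop).eventually
      (gt_mem_nhds (by positivity : 0 < ε / 5))] with k h1 h2 h3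
    simp only [Function.comp] at h3
    linarith [hdisc (σ k)]
  have hactC : ∀ (M : ℕ) (t : ℕ → ℝ), Monotone t → t 0 = 0 → t M = T →
      ∑ i ∈ Finset.range M, ‖u (t (i + 1)) - u (t i)‖ ^ 2 / (t (i + 1) - t i) ≤ C := by
    intro M t htm ht0 htM
    have htI : ∀ i ≤ M, t i ∈ Icc 0 T := fun i hi =>
      ⟨ht0.symm.le.trans (htm i.zero_le), (htm hi).trans htM.le⟩
    refine le_of_tendsto (x := atTop) (f := fun k => ∑ i ∈ Finset.range M,
      ‖∫ r in (t i)..(t (i + 1)), v (σ k) r‖ ^ 2 / (t (i + 1) - t i))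
      (tendsto_finsetSum _ fun i hi => ?_) (Eventually.of_forall fun k => ?_)
    · have hi := Finset.mem_range.1 hi
      refine (((hptw _ (htI (i + 1) hi)).sub (hptw _ (htI i hi.le))).congr
        fun k => ?_).norm.pow 2 |>.div_const _
      rw [add_sub_add_left_eq_sub, intervalIntegral.integral_interval_sub_left
        (intervalIntegrable_of_memLp (hv _) _ _) (intervalIntegrable_of_memLp (hv _) _ _)]
    · exact (sum_norm_integral_sq_le (hv _) fun i _ => htm i.le_succ).trans
        ((intervalIntegral_norm_sq_le (hv _) (htm M.zero_le)).trans (hvC _))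
  have hu0D : u 0 ∈ subdiffDom φ := by rwa [hu0]
  -- The energy drop estimate for `u` bounds the right-hand side of `hup` by a partition sum of `u`:
  -- this is the absence of loss of action. It needs no derivative of `u`, which is produced only
  -- here.
  obtain ⟨v', hv', hlim, huv, hsq⟩ := exists_tendsto_of_action_bound (fun k => hv (σ k)) hptw (by
    intro ε hε
    obtain ⟨M, t, htm, ht0, htM, hle⟩ := hφ.exists_partition_le hu hT huK hu0D
      ENNReal.toReal_nonneg (ENNReal.ofReal_toReal hStop).ge hactC (by positivity : 0 < ε / 4)
    refine ⟨M, t, htm, ht0, htM, ?_⟩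
    filter_upwards [hup (ε / 2) (by positivity)] with k hk
    rw [hu0] at hle
    linarith)
  have hineq : (φ (u T)).toReal + 1 / 2 * (∫ s in (0 : ℝ)..T, ‖v' s‖ ^ 2) +
      1 / 2 * S.toReal ≤ (φ (u 0)).toReal := by
    have h1 := intervalIntegral_norm_sq_le hv' hT.le
    have h2 : ∫ s, ‖v' s‖ ^ 2 ≤ 2 * (E₀ - (φ (u T)).toReal) - S.toReal :=
      le_of_forall_pos_le_add fun ε hε => le_of_tendsto hsq (hup ε hε)
    rw [hu0]
    linarith
  have hH1 : HasH1Deriv T u v' := hasH1Deriv_of_eq_primitive hT.le hv'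
    fun s hs => huv s (Ioo_subset_Icc_self hs)
  refine ⟨σ, u, hσ, ⟨hu.continuousOn, hu0, v', hH1,
    hφ.ae_neg_mem_subdiff hT hu hv' huv huK hu0D hStop hineq⟩,
    fun k => v (σ k), v', fun k => hasH1Deriv_of_eq_primitive hT.le (hv _)
      fun s hs => hprim _ s (Ioo_subset_Icc_self hs), hH1, ?_, ?_⟩
  · exact tendsto_eLpNorm_of_tendstoUniformlyOn
      (hunif.congr (Eventually.of_forall fun k s hs => (hprim _ s hs).symm))
  · exact tendsto_of_tendsto_of_tendsto_of_le_of_le tendsto_const_nhds hlim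
      (fun _ => zero_le) fun k => eLpNorm_mono_measure _ Measure.restrict_le_self

/-! ### The implicit Euler scheme. -/

lemma IsEulerStep.add_le {φ : H → EReal} {τ : ℝ} {u w : H} (h : IsEulerStep φ τ u w) (v : H) :
    φ u + ((τ / 2 * ‖τ⁻¹ • (u - w)‖ ^ 2 : ℝ) : EReal) ≤
      φ v + ((τ / 2 * ‖τ⁻¹ • (v - w)‖ ^ 2 : ℝ) : EReal) :=
  isMinOn_univ_iff.1 h v

lemma IsEulerStep.ne_top {φ : H → EReal} {τ : ℝ} {u w : H} (h : IsEulerStep φ τ u w)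
    (hw : φ w ≠ ⊤) : φ u ≠ ⊤ := by
  intro hu
  have := h.add_le w
  rw [hu, EReal.top_add_coe, top_le_iff] at this
  simp [hw] at this

lemma IsEulerStep.toReal_add_le {φ : H → EReal} (hb : ∀ u, φ u ≠ ⊥) {τ : ℝ} {u w : H}
    (h : IsEulerStep φ τ u w) (hw : φ w ≠ ⊤) {v : H} (hv : φ v ≠ ⊤) :
    (φ u).toReal + τ / 2 * ‖τ⁻¹ • (u - w)‖ ^ 2 ≤ (φ v).toReal + τ / 2 * ‖τ⁻¹ • (v - w)‖ ^ 2 := by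
  have := h.add_le v
  rw [← EReal.coe_toReal (h.ne_top hw) (hb u), ← EReal.coe_toReal hv (hb v)] at this
  exact_mod_cast this

/-- The Euler–Lagrange equation of a step of the implicit Euler scheme. -/
lemma IsEulerStep.mem_subdiff {φ : H → EReal} (hb : ∀ u, φ u ≠ ⊥) {τ : ℝ} (hτ : 0 < τ) {u w : H}
    (h : IsEulerStep φ τ u w) (hw : φ w ≠ ⊤) : -(τ⁻¹ • (u - w)) ∈ subdiff φ u := by
  have hu := h.ne_top hw
  refine (mem_subdiff_iff (hb u)).2 ⟨hu, fun ε hε => ?_⟩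
  -- On this ball the quadratic remainder `‖v - u‖² / (2 τ)` is at most `ε ‖v - u‖`.
  filter_upwards [Metric.ball_mem_nhds u (by positivity : 0 < 2 * τ * ε)] with v hv
  by_cases hvt : φ v = ⊤
  · simp [hvt]
  have h1 := h.toReal_add_le hb hw hvt
  rw [← EReal.coe_toReal hu (hb u), ← EReal.coe_toReal hvt (hb v)]
  norm_cast
  rw [Metric.mem_ball, dist_eq_norm] at hv
  have h2 : ‖v - w‖ ^ 2 = ‖u - w‖ ^ 2 + 2 * inner ℝ (u - w) (v - u) + ‖v - u‖ ^ 2 := by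
    rw [← norm_add_sq_real, sub_add_sub_comm]
    congr 2
    abel
  have h3 : τ⁻¹ / 2 * ‖v - u‖ ^ 2 ≤ ε * ‖v - u‖ := by
    have : τ⁻¹ / 2 * ‖v - u‖ ≤ ε := by
      calc τ⁻¹ / 2 * ‖v - u‖ ≤ τ⁻¹ / 2 * (2 * τ * ε) := by gcongr
        _ = ε := by field_simp
    nlinarith [norm_nonneg (v - u)]
  have h4 : ∀ x : H, τ / 2 * ‖τ⁻¹ • x‖ ^ 2 = τ⁻¹ / 2 * ‖x‖ ^ 2 := by
    intro x
    rw [norm_smul, Real.norm_eq_abs, abs_of_pos (inv_pos.2 hτ)]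
    field_simp
  rw [h4, h4, h2] at h1
  rw [inner_neg_left, inner_smul_left]
  simp only [conj_trivial]
  linarith

lemma TimePartition.sum_step {T : ℝ} (P : TimePartition T) :
    ∑ i ∈ Finset.range P.N, P.step i = T := by
  simp only [TimePartition.step]
  rw [Finset.sum_range_sub (fun i => P.t i), P.t_last, P.t_zero, sub_zero]

/-- The implicit Euler scheme stays in the domain of the subdifferential, and its residual tends
to zero. -/
theorem IsRegularEnergy.euler_residual_tendsto {φ : H → EReal} (hφ : IsRegularEnergy φ) {T : ℝ}
    (hT : 0 < T) {u₀ : H} (hu₀ : u₀ ∈ subdiffDom φ) {P : ℕ → TimePartition T}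
    (hP : Tendsto (fun n => (P n).fineness) atTop (𝓝 0)) {w : ℕ → ℕ → H} (hw0 : ∀ n, w n 0 = u₀)
    (hE : ∀ n, ∀ i < (P n).N, IsEulerStep φ ((P n).step i) (w n (i + 1)) (w n i)) :
    (∀ n, ∀ i ≤ (P n).N, w n i ∈ subdiffDom φ) ∧
      Tendsto (fun n => residual φ (P n) (w n)) atTop (𝓝 0) := by
  have htop : ∀ {x}, x ∈ subdiffDom φ → φ x ≠ ⊤ := fun ⟨ξ, hξ⟩ => hξ.1
  have hD : ∀ n, ∀ i ≤ (P n).N, w n i ∈ subdiffDom φ := by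
    intro n i
    induction i with
    | zero => intro _; rwa [hw0]
    | succ i ih =>
      intro hi
      exact ⟨_, (hE n i hi).mem_subdiff hφ.ne_bot ((P n).step_pos hi) (htop (ih (by omega)))⟩
  refine ⟨hD, ?_⟩
  set E₀ := (φ u₀).toReal
  obtain ⟨m, hm⟩ := hφ.exists_le_toReal (htop hu₀)
  have hdec : ∀ n, ∀ k ≤ (P n).N, (φ (w n k)).toReal +
      1 / 2 * ∑ i ∈ Finset.range k, (P n).step i * ‖(P n).velocity (w n) i‖ ^ 2 ≤ E₀ := by
    intro n k
    induction k with
    | zero => intro _; simp [hw0, E₀]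
    | succ k ih =>
      intro hk
      have h1 := (hE n k hk).toReal_add_le hφ.ne_bot (htop (hD n k (by omega)))
        (htop (hD n k (by omega)))
      rw [sub_self, smul_zero, norm_zero] at h1
      rw [Finset.sum_range_succ, TimePartition.velocity]
      linarith [ih (by omega)]
  have hterm : ∀ n, ∀ i < (P n).N, 0 ≤ (P n).step i * ‖(P n).velocity (w n) i‖ ^ 2 :=
    fun n i hi => mul_nonneg ((P n).step_pos hi).le (sq_nonneg _)
  have hK : ∀ n, ∀ i ≤ (P n).N, φ (w n i) ≤ (E₀ : EReal) := by
    intro n i hi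
    refine hφ.le_coe (htop (hD n i hi)) ?_
    have := Finset.sum_nonneg fun j (hj : j ∈ Finset.range i) =>
      hterm n j ((Finset.mem_range.1 hj).trans_le hi)
    linarith [hdec n i hi]
  set C := 2 * (E₀ - m)
  have hC0 : 0 ≤ C := by linarith [hm u₀ (htop hu₀)]
  have hC : ∀ n, ∑ i ∈ Finset.range (P n).N, (P n).step i * ‖(P n).velocity (w n) i‖ ^ 2 ≤ C := by
    intro n
    linarith [hdec n _ le_rfl, hm _ (htop (hD n _ le_rfl))]
  rw [Metric.tendsto_nhds]
  intro ε hε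
  -- Each positive part is at most `δ τ ‖V‖ ≤ δ/2 (τ ‖V‖² + τ)`, so the residual is at most `δ/2 (C
  -- + T) = ε / 2`.
  set δ := ε / (C + T)
  have hδ : 0 < δ := by positivity
  obtain ⟨r, hr, hconv⟩ := hφ.almost_convex E₀ δ hδ
  have hfine : ∀ᶠ n in atTop, (P n).fineness * C < r ^ 2 := by
    have : Tendsto (fun n => (P n).fineness * C) atTop (𝓝 0) := by simpa using hP.mul_const C
    exact this.eventually (gt_mem_nhds (by positivity))
  filter_upwards [hfine] with n hn
  rw [Real.dist_0_eq_abs, abs_of_nonneg (residual_nonneg _ _ _)]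
  have hle : ∀ i ∈ Finset.range (P n).N, max (G φ ((P n).step i) (w n (i + 1)) (w n i)) 0 ≤
      δ * (1 / 2) * ((P n).step i * ‖(P n).velocity (w n) i‖ ^ 2 + (P n).step i) := by
    intro i hi
    have hi := Finset.mem_range.1 hi
    have hτ := (P n).step_pos hi
    have hξ := (hE n i hi).mem_subdiff hφ.ne_bot hτ (htop (hD n i hi.le))
    set V := (P n).velocity (w n) i
    change -V ∈ _ at hξ
    have hΔ : w n i - w n (i + 1) = -((P n).step i • V) := by
      simp only [V, TimePartition.velocity]
      rw [smul_smul, mul_inv_cancel₀ hτ.ne', one_smul, neg_sub]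
    have hΔn : ‖w n i - w n (i + 1)‖ = (P n).step i * ‖V‖ := by
      rw [hΔ, norm_neg, norm_smul, Real.norm_eq_abs, abs_of_pos hτ]
    -- The squared increment is `τ` times `τ ‖V‖²`, hence at most the fineness times `C`.
    have hsmall : ‖w n i - w n (i + 1)‖ < r := by
      refine lt_of_pow_lt_pow_left₀ 2 hr.le (lt_of_le_of_lt ?_ hn)
      rw [hΔn, mul_pow, sq ((P n).step i), mul_assoc]
      refine mul_le_mul ((P n).step_le_fineness hi) ?_ (hterm n i hi)
        (hτ.le.trans ((P n).step_le_fineness hi))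
      exact (Finset.single_le_sum (f := fun i => (P n).step i * ‖(P n).velocity (w n) i‖ ^ 2)
        (fun j hj => hterm n j (Finset.mem_range.1 hj)) (Finset.mem_range.2 hi)).trans (hC n)
    -- Almost convexity is based at the new value and tested at the old one; with subgradient `-V`
    -- it supplies the full `τ ‖V‖²`, where minimality alone gives half.
    have h1 := hconv _ _ _ (hK n (i + 1) hi) (hK n i hi.le) hξ hsmall
    rw [hΔn, hΔ, inner_neg_neg, inner_smul_right, real_inner_self_eq_norm_sq] at h1
    refine max_le ?_ (by positivity)
    rw [G, hφ.single.subgrad_eq hξ, norm_neg]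
    change _ + (P n).step i / 2 * ‖V‖ ^ 2 + _ - _ ≤ _
    nlinarith [mul_nonneg (mul_nonneg hδ.le hτ.le) (sq_nonneg (‖V‖ - 1))]
  have hsum := Finset.sum_le_sum hle
  rw [← Finset.mul_sum, Finset.sum_add_distrib, (P n).sum_step] at hsum
  have hδC : δ * (C + T) = ε := by
    simp only [δ]
    field_simp
  have hmul := mul_le_mul_of_nonneg_left (hC n) hδ.le
  rw [residual]
  linarith

end DeGiorgi

end

theorem mainTheorem4 {H : Type*} [NormedAddCommGroup H] [InnerProductSpace ℝ H]
    [CompleteSpace H] [TopologicalSpace.SeparableSpace H]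
    (φ₁ : H → EReal) (φ₂ : H → ℝ) (α : ℝ≥0)
    (hconv : DeGiorgi.IsConvex φ₁) (hproper : DeGiorgi.IsProper φ₁)
    (hlsc : LowerSemicontinuous φ₁) (hsingle : DeGiorgi.IsSingleValued φ₁)
    (hα₀ : 0 < α) (hα₁ : α ≤ 1) (hφ₂ : DeGiorgi.IsC1HolderLoc α φ₂)
    (hcompact : DeGiorgi.HasCompactSublevels (DeGiorgi.energy φ₁ φ₂))
    (T : ℝ) (hT : 0 < T)
    (u₀ : H) (hu₀ : u₀ ∈ DeGiorgi.subdiffDom (DeGiorgi.energy φ₁ φ₂))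
    (P : ℕ → DeGiorgi.TimePartition T)
    (hP : Tendsto (fun n => (P n).fineness) atTop (𝓝 0)) :
    (∀ w : ℕ → ℕ → H, (∀ n, w n 0 = u₀) →
      (∀ n, ∀ i ≤ (P n).N, w n i ∈ DeGiorgi.subdiffDom (DeGiorgi.energy φ₁ φ₂)) →
      Tendsto (fun n => DeGiorgi.residual (DeGiorgi.energy φ₁ φ₂) (P n) (w n)) atTop (𝓝 0) →
      DeGiorgi.SubconvergesToSolution (DeGiorgi.energy φ₁ φ₂) T u₀ P w) ∧
    (∀ w : ℕ → ℕ → H, (∀ n, w n 0 = u₀) →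
      (∀ n, ∀ i < (P n).N,
        DeGiorgi.IsEulerStep (DeGiorgi.energy φ₁ φ₂) ((P n).step i) (w n (i + 1)) (w n i)) →
      (∀ n, ∀ i ≤ (P n).N, w n i ∈ DeGiorgi.subdiffDom (DeGiorgi.energy φ₁ φ₂)) ∧
      Tendsto (fun n => DeGiorgi.residual (DeGiorgi.energy φ₁ φ₂) (P n) (w n)) atTop (𝓝 0) ∧
      DeGiorgi.SubconvergesToSolution (DeGiorgi.energy φ₁ φ₂) T u₀ P w) := by
  have hφ := DeGiorgi.isRegularEnergy_energy hconv hproper hlsc hsingle hφ₂.1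
    (hφ₂.continuous_fderiv hα₀) hcompact
  refine ⟨fun w hw0 hD hres => hφ.subconvergesToSolution hT hu₀ hP hw0 hD hres,
    fun w hw0 hE => ?_⟩
  obtain ⟨hD, hres⟩ := hφ.euler_residual_tendsto hT hu₀ hP hw0 hE
  exact ⟨hD, hres, hφ.subconvergesToSolution hT hu₀ hP hw0 hD hres⟩
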